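/- Let $k$ be a field, $n\ge 80$ and $0\le s\le 25$ integers, and $u=\binom{n+1}{2}-s$. For a set $W$ of forms of the same degree in $k[x_1,\dots,x_n]$, let $k[W]$ be the subalgebra generated by $W$, with Hilbert function $\operatorname{HF}(k[W],i)=\dim_k \operatorname{span}_k(W^i)$, where $W^i$ is the set of products of $i$ elements of $W$. Order the monomials of degree two by $x_ax_b>_{\mathrm{Lex}}x_cx_d$ (with $a\le b$, $c\le d$) if $a<c$, or if $a=c$ and $b<d$, and let $\operatorname{Lex}(u)$ be the set of the $u$ greatest monomials of degree two in $x_1,\dots,x_n$. A set $M$ of monomials is strongly stable if $m\in M$, $x_a\mid m$ and $b<a$ imply $(x_b/x_a)m\in M$; let $L(n,2,u,i)$ be the minimum of $\operatorname{HF}(k[M],i)$ over all strongly stable sets $M$ of $u$ monomials of degree two in $x_1,\dots,x_n$. Then $k[\operatorname{Lex}(u)]$ has (asymptotically) minimal Hilbert function among all subalgebras of $k[x_1,\dots,x_n]$ generated by $u$ linearly independent forms of degree two: $\operatorname{Lex}(u)$ is a set of $u$ linearly independent quadratic forms, and there is a number $N$ such that for all $i>N$ $$\operatorname{HF}(k[\operatorname{Lex}(u)],i)=L(n,2,u,i),$$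 and $\operatorname{HF}(k[\operatorname{Lex}(u)],i)\le \operatorname{HF}(k[W],i)$ for every set $W$ of $u$ linearly independent forms of degree two in $k[x_1,\dots,x_n]$. -/

import Mathlib

open scoped Pointwise

namespace QuadricSubalgebra

/-- The Hilbert function of `k[W]`, for a set `W` of forms of the same degree: the value at `i` is
the dimension of the span of the set `W ^ i` of all products of `i` elements of `W`. -/
noncomputable def hilbertFn (k : Type*) [Field k] {n : ℕ} (W : Set (MvPolynomial (Fin n) k))
    (i : ℕ) : ℕ :=
  Module.finrank k (Submodule.span k (W ^ i))

/-- `W` is a linearly independent set of `u` forms of degree `d` in `k[x_1, …, x_n]`. -/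
structure IsFormSet (k : Type*) [Field k] {n : ℕ} (d u : ℕ)
    (W : Set (MvPolynomial (Fin n) k)) : Prop where
  finite : W.Finite
  card : W.ncard = u
  homogeneous : ∀ f ∈ W, f.IsHomogeneous d
  linearIndep : LinearIndepOn k id W

/-- A set of monomials of degree `d` in `n` variables, given by their exponent vectors, is strongly
stable if replacing a variable that divides a member by an earlier one stays in the set. -/
def IsStronglyStable {n : ℕ} (d : ℕ) (M : Set (Fin n →₀ ℕ)) : Prop :=
  (∀ m ∈ M, m.degree = d) ∧
    ∀ m ∈ M, ∀ i j : Fin n, m i ≠ 0 → j < i →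
      m - Finsupp.single i 1 + Finsupp.single j 1 ∈ M

/-- The monomials with exponent vectors in `M`, as elements of `k[x_1, …, x_n]`. -/
def monomialForms (k : Type*) [Field k] {n : ℕ} (M : Set (Fin n →₀ ℕ)) :
    Set (MvPolynomial (Fin n) k) :=
  (fun m => MvPolynomial.monomial m (1 : k)) '' M

/-- `L(n, d, u, i)`: the minimal value at `i` of the Hilbert function of `k[W]`, among the strongly
stable sets `W` of `u` monomials of degree `d` in `n` variables. -/
noncomputable def minStronglyStable (k : Type*) [Field k] (n d u i : ℕ) : ℕ :=
  sInf {h | ∃ M : Set (Fin n →₀ ℕ), IsStronglyStable d M ∧ M.ncard = u ∧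
    h = hilbertFn k (monomialForms k M) i}

/-- `x_i x_j >_Lex x_k x_l`, where `p = (i, j)` and `q = (k, l)` with `i ≤ j` and `k ≤ l`. -/
def LexGT {n : ℕ} (p q : Fin n × Fin n) : Prop :=
  p.1 < q.1 ∨ (p.1 = q.1 ∧ p.2 < q.2)

/-- The pairs `(i, j)` with `i ≤ j` for which `x_i x_j` is among the `u` greatest monomials of degree
two in `x_1, …, x_n`: fewer than `u` monomials are greater than `x_i x_j`. -/
def lexPairs (n u : ℕ) : Set (Fin n × Fin n) :=
  {p | p.1 ≤ p.2 ∧ {q : Fin n × Fin n | q.1 ≤ q.2 ∧ LexGT q p}.ncard < u}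

/-- `Lex(u)`, as a set of monomials in `k[x_1, …, x_n]`. -/
def lexForms (k : Type*) [Field k] (n u : ℕ) : Set (MvPolynomial (Fin n) k) :=
  (fun p : Fin n × Fin n => MvPolynomial.X p.1 * MvPolynomial.X p.2) '' lexPairs n u

end QuadricSubalgebra

/-! Reduction to monomials. The leading monomials of the span of `W` generate an algebra whose
Hilbert function is at most that of `k[W]`. If a set of quadratic monomials is not strongly stable,
some substitution x_a ↦ x_a + x_b with b < a, followed by taking leading monomials, yields a set
that is larger in a colex order and whose Hilbert function is nowhere larger (`exists_colex_lt`). A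
colex-maximal candidate is therefore strongly stable. For monomials only cardinalities of sumsets
matter, so the substitutions can be made over ℚ whatever `k` is.

Gaps. Let M be strongly stable with s quadratic monomials missing. The missing monomials form rows
l_0 > l_1 > ..., a strict partition of s, where row j belongs to the variable with j later ones. A
greedy pairing (`mem_sumset_of_sum_le`) shows that a monomial of degree 2i that is not a product of
i members of M has, for some nonzero row j, larger degree in the last j + 1 variables than in the
first n - (j + l_j).

Densities. Among all monomials of large degree, those with larger degree in a given variables than
in c others have asymptotic proportion `chooseSum m a` / 2^m, m = a + c - 1. This is the chance that
a sum of a exponential variables exceeds a sum of c others, i.e. a binomial tail. The discrete proof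
compares two exponents, removes the smaller from both and doubles it, which gives Pascal's recursion
up to bounded shifts of degree.

Comparison. Write s = (r+1).choose 2 + t with t ≤ r. The gaps of Lex contain E₀ (last r variables
against the first n - r) and E₁ (last t against the first n - r - 1). If M has fewer than r rows,
its gaps have a coefficient of smaller order in n than E₀. Otherwise it has exactly r rows and the
excesses j + l_j - r form a partition of t. If all excesses are at most 1, the gaps of M lie in E₀ ∪
E₁. If the first is at least 2, fewer than t rows are in excess, and their part outside E₀ is of
smaller order in n than E₁ \ E₀. The hypotheses n ≥ 80 and s ≤ 25 make these order comparisons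
numerical inequalities. -/

namespace QuadricSubalgebra

open Finset

/-! ### Counting monomials by comparing the degrees in two groups of variables -/

section Counting

set_option linter.unusedSectionVars false

variable {ι : Type*} [Fintype ι] [DecidableEq ι]

open Classical in
/-- The exponent vectors of degree `D` satisfying `Q` whose degree in the variables of `A` exceeds
the degree in the variables of `P`. -/
noncomputable def region (A P : Finset ι) (Q : (ι →₀ ℕ) → Prop) (D : ℕ) : Finset (ι →₀ ℕ) :=
  {x ∈ finsuppAntidiag univ D | (∑ q ∈ P, x q < ∑ q ∈ A, x q) ∧ Q x}

open Classical in
/-- The exponent vectors of degree `D` satisfying `Q`. -/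
noncomputable def degreeSlice (Q : (ι →₀ ℕ) → Prop) (D : ℕ) : Finset (ι →₀ ℕ) :=
  {x ∈ finsuppAntidiag univ D | Q x}

theorem mem_region {A P : Finset ι} {Q : (ι →₀ ℕ) → Prop} {D : ℕ} {x : ι →₀ ℕ} :
    x ∈ region A P Q D ↔ ∑ q, x q = D ∧ (∑ q ∈ P, x q < ∑ q ∈ A, x q) ∧ Q x := by
  simp [region, mem_finsuppAntidiag]

theorem mem_degreeSlice {Q : (ι →₀ ℕ) → Prop} {D : ℕ} {x : ι →₀ ℕ} :
    x ∈ degreeSlice Q D ↔ ∑ q, x q = D ∧ Q x := by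
  simp [degreeSlice, mem_finsuppAntidiag]

/-- Lower the exponent of `i` by `c`, then raise those of `j` and `k` by `d` and `e`. -/
noncomputable def transfer (x : ι →₀ ℕ) (i : ι) (c : ℕ) (j : ι) (d : ℕ) (k : ι) (e : ℕ) : ι →₀ ℕ :=
  x - Finsupp.single i c + Finsupp.single j d + Finsupp.single k e

theorem transfer_apply (x : ι →₀ ℕ) (i : ι) (c : ℕ) (j : ι) (d : ℕ) (k : ι) (e : ℕ) (q : ι) :
    transfer x i c j d k e q =
      x q - (if i = q then c else 0) + (if j = q then d else 0) + (if k = q then e else 0) := by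
  simp [transfer, Finsupp.single_apply]

theorem sum_transfer (F : Finset ι) {x : ι →₀ ℕ} {i : ι} {c : ℕ} (hc : c ≤ x i) (j : ι) (d : ℕ)
    (k : ι) (e : ℕ) :
    ∑ q ∈ F, transfer x i c j d k e q + (if i ∈ F then c else 0) =
      ∑ q ∈ F, x q + (if j ∈ F then d else 0) + (if k ∈ F then e else 0) := by
  have h : ∀ q, transfer x i c j d k e q + (if i = q then c else 0) =
      x q + (if j = q then d else 0) + (if k = q then e else 0) := by
    intro q
    rw [transfer_apply]
    by_cases hq : i = q
    · subst hq
      simp only [if_true]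
      omega
    · simp [hq]
  have := Finset.sum_congr (rfl : F = F) (fun q _ => h q)
  simpa [Finset.sum_add_distrib, Finset.sum_ite_eq] using this

theorem two_mul_card_le {α β : Type*} {X : Finset α} {Y : Finset β} (f : α → ℕ → β)
    (hf : ∀ x ∈ X, ∀ ε < 2, f x ε ∈ Y)
    (hinj : ∀ x ∈ X, ∀ ε < 2, ∀ x' ∈ X, ∀ ε' < 2, f x ε = f x' ε' → x = x' ∧ ε = ε') :
    2 * X.card ≤ Y.card := by
  have h : (X ×ˢ range 2).card ≤ Y.card := by
    refine Finset.card_le_card_of_injOn (fun p => f p.1 p.2) ?_ ?_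
    · rintro ⟨x, ε⟩ hp
      simp only [coe_product, Set.mem_prod, mem_coe, mem_range] at hp
      exact hf _ hp.1 _ hp.2
    · rintro ⟨x, ε⟩ hp ⟨x', ε'⟩ hp' heq
      simp only [coe_product, Set.mem_prod, mem_coe, mem_range] at hp hp'
      obtain ⟨h1, h2⟩ := hinj _ hp.1 _ hp.2 _ hp'.1 _ hp'.2 heq
      simp [h1, h2]
  simpa [mul_comm] using h

theorem card_le_two_mul {α β : Type*} {X : Finset α} {Y : Finset β} (f : α → β) (g : α → ℕ)
    (hg : ∀ x ∈ X, g x < 2) (hf : ∀ x ∈ X, f x ∈ Y)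
    (hinj : ∀ x ∈ X, ∀ x' ∈ X, f x = f x' → g x = g x' → x = x') :
    X.card ≤ 2 * Y.card := by
  have h : X.card ≤ (Y ×ˢ range 2).card := by
    refine Finset.card_le_card_of_injOn (fun x => (f x, g x)) ?_ ?_
    · intro x hx
      simpa using ⟨hf x hx, Nat.le_of_lt_succ (hg x hx)⟩
    · intro x hx x' hx' heq
      simp only [Prod.mk.injEq] at heq
      exact hinj x hx x' hx' heq.1 heq.2
  simpa [mul_comm] using h

/-- `Q` does not depend on the exponents of the variables in `K`. -/
def IndepOf (K : Finset ι) (Q : (ι →₀ ℕ) → Prop) : Prop :=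
  ∀ x y : ι →₀ ℕ, (∀ q ∉ K, x q = y q) → Q x → Q y

theorem IndepOf.transfer {K : Finset ι} {Q : (ι →₀ ℕ) → Prop} (hQ : IndepOf K Q) {x : ι →₀ ℕ}
    {i j k : ι} (hi : i ∈ K) (hj : j ∈ K) (hk : k ∈ K) (c d e : ℕ) (hx : Q x) :
    Q (transfer x i c j d k e) := by
  refine hQ x _ (fun q hq => ?_) hx
  rw [transfer_apply, if_neg, if_neg, if_neg] <;> first | rfl | (rintro rfl; contradiction)

/-- The smaller exponent x_j is subtracted from x_i and doubled in place. The position j then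
carries no constraint and can be dropped from P. -/
theorem two_mul_card_filter_region_le {A P K : Finset ι} {Q : (ι →₀ ℕ) → Prop} {i j : ι}
    (hAP : Disjoint A P) (hi : i ∈ A) (hj : j ∈ P) (hA : A ⊆ K) (hP : P ⊆ K) (hQ : IndepOf K Q)
    (D : ℕ) :
    2 * ((region A P Q D).filter (fun x => x j ≤ x i)).card ≤
      (region A (P.erase j) Q (D + 1)).card := by
  have hij : i ≠ j := fun h => Finset.disjoint_left.1 hAP hi (h ▸ hj)
  have hjA : j ∉ A := fun h => Finset.disjoint_left.1 hAP h hj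
  have hiP : i ∉ P := fun h => Finset.disjoint_left.1 hAP hi h
  -- The new exponent of j is 2 x_j + ε, so its parity recovers ε; the summand 1 - ε at i makes the
  -- total degree D + 1.
  refine two_mul_card_le (fun x ε => transfer x i (x j) j (x j + ε) i (1 - ε)) ?_ ?_
  · intro x hx ε hε
    simp only [mem_filter, mem_region] at hx
    obtain ⟨⟨hD, hlt, hq⟩, hle⟩ := hx
    have h1 := sum_transfer univ hle j (x j + ε) i (1 - ε)
    have h2 := sum_transfer A hle j (x j + ε) i (1 - ε)
    have h3 := sum_transfer (P.erase j) hle j (x j + ε) i (1 - ε)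
    have h4 := Finset.add_sum_erase P (fun q => x q) hj
    simp only [mem_univ, if_true, hi, hjA, if_false, mem_erase, hij, ne_eq, not_true_eq_false,
      false_and, hiP, and_false] at h1 h2 h3 h4
    refine mem_region.2 ⟨by omega, by omega, hQ.transfer (hA hi) (hP hj) (hA hi) _ _ _ hq⟩
  · intro x hx ε hε x' hx' ε' hε' heq
    simp only [mem_filter] at hx hx'
    have hpt := fun q => DFunLike.congr_fun heq q
    simp only [transfer_apply] at hpt
    have h1 := hpt j
    have h2 := hpt i
    simp only [hij, if_true, if_false, hij.symm] at h1 h2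
    have hε : ε = ε' := by omega
    refine ⟨?_, hε⟩
    ext q
    by_cases hqi : i = q
    · subst hqi; omega
    by_cases hqj : j = q
    · subst hqj; omega
    simpa [hqi, hqj] using hpt q

theorem two_mul_card_filter_not_region_le {A P K : Finset ι} {Q : (ι →₀ ℕ) → Prop} {i j : ι}
    (hAP : Disjoint A P) (hi : i ∈ A) (hj : j ∈ P) (hA : A ⊆ K) (hP : P ⊆ K) (hQ : IndepOf K Q)
    (D : ℕ) :
    2 * ((region A P Q D).filter (fun x => ¬ x j ≤ x i)).card ≤
      (region (A.erase i) P Q (D + 1)).card := by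
  have hij : i ≠ j := fun h => Finset.disjoint_left.1 hAP hi (h ▸ hj)
  have hjA : j ∉ A := fun h => Finset.disjoint_left.1 hAP h hj
  have hiP : i ∉ P := fun h => Finset.disjoint_left.1 hAP hi h
  rcases (A.erase i).eq_empty_or_nonempty with hA0 | ⟨k, hk⟩
  -- If A = {i}, then x_j is at most the degree in P, which is below x_i, so this case does not
  -- occur.
  · have : (region A P Q D).filter (fun x => ¬ x j ≤ x i) = ∅ := by
      refine Finset.eq_empty_of_forall_notMem fun x hx => ?_
      simp only [mem_filter, mem_region] at hx
      have h4 := Finset.add_sum_erase P (fun q => x q) hj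
      have h5 := Finset.add_sum_erase A (fun q => x q) hi
      simp only [hA0, sum_empty] at h4 h5
      omega
    rw [this]; simp
  obtain ⟨hki, hkA⟩ := Finset.mem_erase.1 hk
  have hkj : k ≠ j := fun h => hjA (h ▸ hkA)
  have hkP : k ∉ P := fun h => Finset.disjoint_left.1 hAP hkA h
  -- Now x_i is the smaller exponent and i leaves A. Another variable k of A absorbs the correction
  -- 2 - ε that brings the degree to D + 1.
  refine two_mul_card_le (fun x ε => transfer x j (x i + 1) i (x i + ε) k (2 - ε)) ?_ ?_
  · intro x hx ε hε
    simp only [mem_filter, mem_region, not_le] at hx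
    obtain ⟨⟨hD, hlt, hq⟩, hle⟩ := hx
    have h1 := sum_transfer univ hle i (x i + ε) k (2 - ε)
    have h2 := sum_transfer (A.erase i) hle i (x i + ε) k (2 - ε)
    have h3 := sum_transfer P hle i (x i + ε) k (2 - ε)
    have h4 := Finset.add_sum_erase A (fun q => x q) hi
    simp only [mem_univ, if_true, hj, hjA, if_false, mem_erase, ne_eq, not_true_eq_false,
      false_and, hiP, and_false, hki, hkA, not_false_eq_true, and_self, hkP, add_zero,
      Nat.succ_eq_add_one] at h1 h2 h3 h4
    refine mem_region.2 ⟨by omega, by omega, hQ.transfer (hP hj) (hA hi) (hA hkA) _ _ _ hq⟩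
  · intro x hx ε hε x' hx' ε' hε' heq
    simp only [mem_filter] at hx hx'
    have hpt := fun q => DFunLike.congr_fun heq q
    simp only [transfer_apply] at hpt
    have h1 := hpt j
    have h2 := hpt i
    have h3 := hpt k
    simp only [hij, if_true, if_false, hij.symm, hki, hkj, hki.symm, hkj.symm] at h1 h2 h3
    have hε : ε = ε' := by omega
    refine ⟨?_, hε⟩
    ext q
    by_cases hqi : i = q
    · subst hqi; omega
    by_cases hqj : j = q
    · subst hqj; omega
    by_cases hqk : k = q
    · subst hqk; omega
    simpa [hqi, hqj, hqk] using hpt q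

theorem two_mul_card_region_le {A P K : Finset ι} {Q : (ι →₀ ℕ) → Prop} {i j : ι}
    (hAP : Disjoint A P) (hi : i ∈ A) (hj : j ∈ P) (hA : A ⊆ K) (hP : P ⊆ K) (hQ : IndepOf K Q)
    (D : ℕ) :
    2 * (region A P Q D).card ≤
      (region A (P.erase j) Q (D + 1)).card + (region (A.erase i) P Q (D + 1)).card := by
  have h1 := two_mul_card_filter_region_le hAP hi hj hA hP hQ D
  have h2 := two_mul_card_filter_not_region_le hAP hi hj hA hP hQ D
  have h3 := Finset.card_filter_add_card_filter_not (s := region A P Q D) (fun x => x j ≤ x i)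
  omega

/-- The reverse of the doubling argument: the free exponent is halved, and one half is added to the
other variable of the pair. The lost parity makes each map at most two-to-one, and comparing x_j
with x_i separates the two images. -/
theorem card_region_erase_add_le {A P : Finset ι} {i j : ι}
    (hAP : Disjoint A P) (hi : i ∈ A) (hj : j ∈ P) (D : ℕ) :
    (region A (P.erase j) (fun _ => True) D).card + (region (A.erase i) P (fun _ => True) D).card ≤
      2 * (region A P (fun _ => True) (D + 1)).card := by
  have hij : i ≠ j := fun h => Finset.disjoint_left.1 hAP hi (h ▸ hj)
  have hjA : j ∉ A := fun h => Finset.disjoint_left.1 hAP h hj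
  have hiP : i ∉ P := fun h => Finset.disjoint_left.1 hAP hi h
  have key1 : (region A (P.erase j) (fun _ => True) D).card ≤
      2 * ((region A P (fun _ => True) (D + 1)).filter (fun x => x j < x i)).card := by
    refine card_le_two_mul
      (fun x => transfer x j (x j - x j / 2) i (x j - x j / 2 + 1) i 0) (fun x => x j % 2)
      (fun x _ => Nat.mod_lt _ two_pos) ?_ ?_
    · intro x hx
      obtain ⟨hD, hlt, -⟩ := mem_region.1 hx
      have hle : x j - x j / 2 ≤ x j := Nat.sub_le _ _
      have h1 := sum_transfer univ hle i (x j - x j / 2 + 1) i 0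
      have h2 := sum_transfer A hle i (x j - x j / 2 + 1) i 0
      have h3 := sum_transfer P hle i (x j - x j / 2 + 1) i 0
      have h4 := Finset.add_sum_erase P (fun q => x q) hj
      simp only [mem_univ, if_true, hi, hj, hjA, if_false, hiP] at h1 h2 h3 h4
      refine mem_filter.2 ⟨mem_region.2 ⟨by omega, by omega, trivial⟩, ?_⟩
      simp only [transfer_apply, hij, hij.symm, if_true, if_false]
      omega
    · intro x hx x' hx' heq hmod
      have hpt := fun q => DFunLike.congr_fun heq q
      simp only [transfer_apply] at hpt
      have h1 := hpt j
      have h2 := hpt i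
      simp only [hij, if_true, if_false, hij.symm] at h1 h2
      ext q
      by_cases hqi : i = q
      · subst hqi; omega
      by_cases hqj : j = q
      · subst hqj; omega
      simpa [hqi, hqj] using hpt q
  have key2 : (region (A.erase i) P (fun _ => True) D).card ≤
      2 * ((region A P (fun _ => True) (D + 1)).filter (fun x => ¬ x j < x i)).card := by
    rcases (A.erase i).eq_empty_or_nonempty with hA0 | ⟨k, hk⟩
    · have : region (A.erase i) P (fun _ => True) D = ∅ := by
        refine Finset.eq_empty_of_forall_notMem fun x hx => ?_
        simp [mem_region, hA0] at hx
      simp [this]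
    obtain ⟨hki, hkA⟩ := Finset.mem_erase.1 hk
    have hkj : k ≠ j := fun h => hjA (h ▸ hkA)
    have hkP : k ∉ P := fun h => Finset.disjoint_left.1 hAP hkA h
    refine card_le_two_mul
      (fun x => transfer x i (x i - x i / 2) j (x i / 2) k (1 + x i % 2)) (fun x => x i % 2)
      (fun x _ => Nat.mod_lt _ two_pos) ?_ ?_
    · intro x hx
      obtain ⟨hD, hlt, -⟩ := mem_region.1 hx
      have hle : x i - x i / 2 ≤ x i := Nat.sub_le _ _
      have h1 := sum_transfer univ hle j (x i / 2) k (1 + x i % 2)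
      have h2 := sum_transfer A hle j (x i / 2) k (1 + x i % 2)
      have h3 := sum_transfer P hle j (x i / 2) k (1 + x i % 2)
      have h4 := Finset.add_sum_erase A (fun q => x q) hi
      simp only [mem_univ, if_true, hi, hj, hjA, if_false, hiP, hkA, hkP] at h1 h2 h3 h4
      refine mem_filter.2 ⟨mem_region.2 ⟨by omega, by omega, trivial⟩, ?_⟩
      simp only [transfer_apply, hij, hij.symm, if_true, if_false, hki, hkj]
      omega
    · intro x hx x' hx' heq hmod
      have hpt := fun q => DFunLike.congr_fun heq q
      simp only [transfer_apply] at hpt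
      have h1 := hpt j
      have h2 := hpt i
      have h3 := hpt k
      simp only [hij, if_true, if_false, hij.symm, hki, hkj, hki.symm, hkj.symm] at h1 h2 h3 hmod
      ext q
      by_cases hqi : i = q
      · subst hqi; omega
      by_cases hqj : j = q
      · subst hqj; omega
      by_cases hqk : k = q
      · subst hqk; omega
      have h5 := hpt q
      simpa [hqi, hqj, hqk] using h5
  have h3 := Finset.card_filter_add_card_filter_not
    (s := region A P (fun _ => True) (D + 1)) (fun x => x j < x i)
  omega

/-- The sum of the first `a` binomial coefficients `m.choose 0, m.choose 1, …`. -/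
def chooseSum (m a : ℕ) : ℕ := ∑ j ∈ range a, m.choose j

theorem chooseSum_zero (m : ℕ) : chooseSum m 0 = 0 := by simp [chooseSum]

theorem chooseSum_succ_right (m a : ℕ) : chooseSum m (a + 1) = chooseSum m a + m.choose a := by
  simp [chooseSum, sum_range_succ]

theorem chooseSum_succ_succ (m a : ℕ) :
    chooseSum (m + 1) (a + 1) = chooseSum m (a + 1) + chooseSum m a := by
  induction a with
  | zero => simp [chooseSum]
  | succ a ih =>
    rw [chooseSum_succ_right, ih, Nat.choose_succ_succ', chooseSum_succ_right m (a + 1),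
      chooseSum_succ_right m a]
    omega

theorem chooseSum_self (m : ℕ) : chooseSum m (m + 1) = 2 ^ m := Nat.sum_range_choose m

theorem card_degreeSlice_le_succ {Q : (ι →₀ ℕ) → Prop} {K : Finset ι} (hQ : IndepOf K Q)
    (hK : K.Nonempty) (D : ℕ) : (degreeSlice Q D).card ≤ (degreeSlice Q (D + 1)).card := by
  obtain ⟨k, hk⟩ := hK
  refine Finset.card_le_card_of_injOn (fun x => x + Finsupp.single k 1) ?_ ?_
  · intro x hx
    obtain ⟨h1, h2⟩ := mem_degreeSlice.1 hx
    refine mem_degreeSlice.2 ⟨?_, hQ x _ (fun q hq => ?_) h2⟩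
    · simp [Finset.sum_add_distrib, h1, Finsupp.single_apply]
    · have : k ≠ q := fun h => hq (h ▸ hk)
      simp [this]
  · intro x _ y _ h
    exact add_right_cancel h

theorem monotone_card_degreeSlice {Q : (ι →₀ ℕ) → Prop} {K : Finset ι} (hQ : IndepOf K Q)
    (hK : K.Nonempty) : Monotone fun D => (degreeSlice Q D).card :=
  monotone_nat_of_le_succ (card_degreeSlice_le_succ hQ hK)

/-- Induction on |A| + |P| by `two_mul_card_region_le`; the coefficients obey Pascal's rule
`chooseSum_succ_succ`. Each step raises the degree by one, whence D + m. The side condition `Q` on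
the other variables serves later to multiply two densities. -/
theorem two_pow_mul_card_region_le {K : Finset ι} {Q : (ι →₀ ℕ) → Prop} (hQ : IndepOf K Q) (m : ℕ) :
    ∀ (A P : Finset ι) (D : ℕ), Disjoint A P → A ⊆ K → P ⊆ K → A.card + P.card = m + 1 →
      2 ^ m * (region A P Q D).card ≤ chooseSum m A.card * (degreeSlice Q (D + m)).card := by
  have hsub : ∀ (A P : Finset ι) (D : ℕ), region A P Q D ⊆ degreeSlice Q D := fun A P D x hx => by
    obtain ⟨h1, -, h2⟩ := mem_region.1 hx
    exact mem_degreeSlice.2 ⟨h1, h2⟩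
  have hbase : ∀ (m : ℕ) (A P : Finset ι) (D : ℕ), A ⊆ K → P ⊆ K → A.card + P.card = m + 1 →
      (A = ∅ ∨ P = ∅) →
      2 ^ m * (region A P Q D).card ≤ chooseSum m A.card * (degreeSlice Q (D + m)).card := by
    intro m A P D hA hP hc h
    rcases h with rfl | rfl
    · have : region ∅ P Q D = ∅ := by
        refine Finset.eq_empty_of_forall_notMem fun x hx => ?_
        simp [mem_region] at hx
      simp [this]
    · simp only [card_empty, add_zero] at hc
      rw [hc, chooseSum_self]
      have hK : K.Nonempty := Finset.Nonempty.mono hA (Finset.card_pos.1 (by omega))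
      exact Nat.mul_le_mul_left _ ((Finset.card_le_card (hsub _ _ _)).trans
        (monotone_card_degreeSlice hQ hK (Nat.le_add_right _ _)))
  induction m with
  | zero =>
    intro A P D _ hA hP hc
    refine hbase 0 A P D hA hP hc ?_
    rcases A.eq_empty_or_nonempty with h | h
    · exact Or.inl h
    · have := Finset.card_pos.2 h
      exact Or.inr (Finset.card_eq_zero.1 (by omega))
  | succ m ih =>
    intro A P D hAP hA hP hc
    rcases A.eq_empty_or_nonempty with h | ⟨i, hi⟩
    · exact hbase _ A P D hA hP hc (Or.inl h)
    rcases P.eq_empty_or_nonempty with h | ⟨j, hj⟩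
    · exact hbase _ A P D hA hP hc (Or.inr h)
    have h1 := two_mul_card_region_le hAP hi hj hA hP hQ D
    have hAc := Finset.card_erase_add_one hi
    have hPc := Finset.card_erase_add_one hj
    have h2 := ih A (P.erase j) (D + 1) (hAP.mono_right (erase_subset _ _)) hA
      ((erase_subset _ _).trans hP) (by omega)
    have h3 := ih (A.erase i) P (D + 1) (hAP.mono_left (erase_subset _ _))
      ((erase_subset _ _).trans hA) hP (by omega)
    rw [← hAc, chooseSum_succ_succ, hAc, pow_succ, add_mul, mul_assoc,
      show D + (m + 1) = D + 1 + m by ring]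
    calc _ ≤ 2 ^ m * ((region A (P.erase j) Q (D + 1)).card +
              (region (A.erase i) P Q (D + 1)).card) := Nat.mul_le_mul_left _ h1
      _ ≤ _ := by rw [mul_add]; exact add_le_add h2 h3

theorem chooseSum_mul_le_two_pow_mul_card_region (m : ℕ) :
    ∀ (A P : Finset ι) (D : ℕ), Disjoint A P → A.card + P.card = m + 1 →
      chooseSum m A.card * (degreeSlice (fun _ : ι →₀ ℕ => True) D).card ≤
        2 ^ m * (region A P (fun _ => True) (D + m + 1)).card := by
  have hbase : ∀ (m : ℕ) (A P : Finset ι) (D : ℕ), A.card + P.card = m + 1 →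
      (A = ∅ ∨ P = ∅) →
      chooseSum m A.card * (degreeSlice (fun _ : ι →₀ ℕ => True) D).card ≤
        2 ^ m * (region A P (fun _ => True) (D + m + 1)).card := by
    intro m A P D hc h
    rcases h with rfl | rfl
    · simp [chooseSum_zero]
    · simp only [card_empty, add_zero] at hc
      rw [hc, chooseSum_self]
      obtain ⟨k, hk⟩ := Finset.card_pos.1 (show 0 < A.card by omega)
      refine Nat.mul_le_mul_left _
        -- With P empty, the condition only asks for positive degree in A, which the added power of
        -- k ensures.
        (Finset.card_le_card_of_injOn (fun x => x + Finsupp.single k (m + 1)) ?_ ?_)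
      · intro x hx
        obtain ⟨h1, -⟩ := mem_degreeSlice.1 hx
        refine mem_region.2 ⟨?_, ?_, trivial⟩
        · simp [Finset.sum_add_distrib, h1, Finsupp.single_apply, add_assoc]
        · simp [Finset.sum_add_distrib, Finsupp.single_apply, hk]
      · intro x _ y _ h
        exact add_right_cancel h
  induction m with
  | zero =>
    intro A P D _ hc
    refine hbase 0 A P D hc ?_
    rcases A.eq_empty_or_nonempty with h | h
    · exact Or.inl h
    · have := Finset.card_pos.2 h
      exact Or.inr (Finset.card_eq_zero.1 (by omega))
  | succ m ih =>
    intro A P D hAP hc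
    rcases A.eq_empty_or_nonempty with h | ⟨i, hi⟩
    · exact hbase _ A P D hc (Or.inl h)
    rcases P.eq_empty_or_nonempty with h | ⟨j, hj⟩
    · exact hbase _ A P D hc (Or.inr h)
    have h1 := card_region_erase_add_le hAP hi hj (D + m + 1)
    have hAc := Finset.card_erase_add_one hi
    have hPc := Finset.card_erase_add_one hj
    have h2 := ih A (P.erase j) D (hAP.mono_right (erase_subset _ _)) (by omega)
    have h3 := ih (A.erase i) P D (hAP.mono_left (erase_subset _ _)) (by omega)
    rw [← hAc, chooseSum_succ_succ, hAc, pow_succ, add_mul, mul_assoc,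
      show D + (m + 1) + 1 = D + m + 1 + 1 by ring]
    refine le_trans (add_le_add h2 h3) ?_
    rw [← mul_add]
    exact Nat.mul_le_mul_left _ h1

end Counting

/-! ### Leading monomials and Hilbert functions -/

section InitialMonomials

open MvPolynomial

variable {k : Type*} [Field k] {n : ℕ}

/-- The exponents of the leading monomials, for the lexicographic order, of the nonzero members of a
space of polynomials. -/
def leadingExps (V : Submodule k (MvPolynomial (Fin n) k)) : Set (Fin n →₀ ℕ) :=
  {d | ∃ f ∈ V, f ≠ 0 ∧ MonomialOrder.lex.degree f = d}

theorem leadingExps_mono {V V' : Submodule k (MvPolynomial (Fin n) k)} (h : V ≤ V') :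
    leadingExps V ⊆ leadingExps V' := by
  rintro d ⟨f, hf, h0, hd⟩
  exact ⟨f, h hf, h0, hd⟩

/-- In a linear relation between polynomials with distinct leading exponents, the coefficient at the
greatest exponent involved isolates one term. -/
theorem exists_linearIndependent_leadingExps (V : Submodule k (MvPolynomial (Fin n) k)) :
    ∃ v : leadingExps V → V, LinearIndependent k v := by
  choose f hfV hf0 hfd using fun d : leadingExps V => d.2
  refine ⟨fun d => ⟨f d, hfV d⟩, ?_⟩
  classical
  rw [linearIndependent_iff']
  intro s g hsum
  by_contra! hne
  obtain ⟨d₀, hd₀, hmax⟩ := Finset.exists_max_image (s.filter fun d => g d ≠ 0)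
    (fun d => toLex (d : Fin n →₀ ℕ)) (by
      obtain ⟨d, hd, hgd⟩ := hne
      exact ⟨d, by simp [hd, hgd]⟩)
  obtain ⟨hds, hg0⟩ := Finset.mem_filter.1 hd₀
  have h1 := congrArg (fun v : V => coeff (d₀ : Fin n →₀ ℕ) (v : MvPolynomial (Fin n) k)) hsum
  simp only [AddSubmonoidClass.coe_finsetSum, coeff_sum, Submodule.coe_smul_of_tower, coeff_smul,
    smul_eq_mul, Submodule.coe_zero, coeff_zero] at h1
  rw [Finset.sum_eq_single d₀] at h1
  · rcases mul_eq_zero.1 h1 with h | h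
    · exact hg0 h
    · rw [← hfd d₀] at h
      exact (MonomialOrder.coeff_degree_ne_zero_iff.2 (hf0 d₀)) h
  · intro d hd hne
    by_cases hgd : g d = 0
    · simp [hgd]
    · have hle := hmax d (Finset.mem_filter.2 ⟨hd, hgd⟩)
      have hlt : toLex (d : Fin n →₀ ℕ) < toLex (d₀ : Fin n →₀ ℕ) :=
        lt_of_le_of_ne hle fun h => hne (Subtype.ext (toLex.injective h))
      rw [MonomialOrder.coeff_eq_zero_of_lt (m := MonomialOrder.lex), mul_zero]
      rw [hfd d]
      exact MonomialOrder.lex_lt_iff.2 hlt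
  · exact fun h => (h hds).elim

theorem finite_leadingExps (V : Submodule k (MvPolynomial (Fin n) k)) [FiniteDimensional k V] :
    (leadingExps V).Finite := by
  obtain ⟨v, hv⟩ := exists_linearIndependent_leadingExps V
  exact Set.finite_coe_iff.1 hv.finite

theorem ncard_leadingExps (V : Submodule k (MvPolynomial (Fin n) k)) [FiniteDimensional k V] :
    (leadingExps V).ncard = Module.finrank k V := by
  obtain ⟨v, hv⟩ := exists_linearIndependent_leadingExps V
  have hfin := finite_leadingExps V
  have := hfin.fintype
  rw [← Nat.card_coe_set_eq, Nat.card_eq_fintype_card]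
  refine le_antisymm hv.fintype_card_le_finrank ?_
  -- A member of V is determined by its coefficients at the leading exponents of V, since a nonzero
  -- one has its own leading coefficient among them.
  let φ : V →ₗ[k] (leadingExps V → k) :=
    LinearMap.pi fun d => (lcoeff k (d : Fin n →₀ ℕ)).comp V.subtype
  have hφ : Function.Injective φ := by
    rw [injective_iff_map_eq_zero]
    intro f hf
    by_contra h0
    have hf0 : (f : MvPolynomial (Fin n) k) ≠ 0 := fun h => h0 (Subtype.ext h)
    have := congrFun hf ⟨_, f, f.2, hf0, rfl⟩
    exact (MonomialOrder.coeff_degree_ne_zero_iff.2 hf0) this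
  simpa using LinearMap.finrank_le_finrank_of_injective hφ

/-- The set of sums of `i` elements of `M`. -/
def sumset (M : Set (Fin n →₀ ℕ)) : ℕ → Set (Fin n →₀ ℕ)
  | 0 => {0}
  | i + 1 => sumset M i + M

theorem sumset_finite {M : Set (Fin n →₀ ℕ)} (hM : M.Finite) (i : ℕ) : (sumset M i).Finite := by
  induction i with
  | zero => exact Set.finite_singleton 0
  | succ i ih => exact ih.add hM

theorem sumset_subset_leadingExps {M : Set (Fin n →₀ ℕ)} {V : Submodule k (MvPolynomial (Fin n) k)}
    (h : M ⊆ leadingExps V) (i : ℕ) : sumset M i ⊆ leadingExps (V ^ i) := by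
  induction i with
  | zero =>
    rintro d rfl
    exact ⟨1, by rw [pow_zero]; exact Submodule.one_le.1 le_rfl, one_ne_zero, MonomialOrder.degree_one⟩
  | succ i ih =>
    rintro d ⟨a, ha, b, hb, rfl⟩
    obtain ⟨f, hf, hf0, hfd⟩ := ih ha
    obtain ⟨g, hg, hg0, hgd⟩ := h hb
    refine ⟨f * g, ?_, mul_ne_zero hf0 hg0, ?_⟩
    · rw [pow_succ]
      exact Submodule.mul_mem_mul hf hg
    · rw [MonomialOrder.degree_mul hf0 hg0, hfd, hgd]

theorem finiteDimensional_pow (V : Submodule k (MvPolynomial (Fin n) k)) [FiniteDimensional k V]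
    (i : ℕ) : FiniteDimensional k (V ^ i : Submodule k (MvPolynomial (Fin n) k)) :=
  Module.Finite.iff_fg.2 ((Module.Finite.iff_fg.1 ‹_›).pow i)

theorem ncard_sumset_le_finrank {M : Set (Fin n →₀ ℕ)} {V : Submodule k (MvPolynomial (Fin n) k)}
    [FiniteDimensional k V] (h : M ⊆ leadingExps V) (i : ℕ) :
    (sumset M i).ncard ≤ Module.finrank k (V ^ i : Submodule k (MvPolynomial (Fin n) k)) := by
  have := finiteDimensional_pow V i
  rw [← ncard_leadingExps]
  exact Set.ncard_le_ncard (sumset_subset_leadingExps h i) (finite_leadingExps _)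

theorem hilbertFn_eq_finrank_pow (W : Set (MvPolynomial (Fin n) k)) (i : ℕ) :
    hilbertFn k W i = Module.finrank k
      (Submodule.span k W ^ i : Submodule k (MvPolynomial (Fin n) k)) := by
  rw [hilbertFn, Submodule.span_pow]

theorem monomialForms_pow (M : Set (Fin n →₀ ℕ)) (i : ℕ) :
    monomialForms k M ^ i = monomialForms k (sumset M i) := by
  induction i with
  | zero => rw [pow_zero, monomialForms, sumset, Set.image_singleton]; rfl
  | succ i ih =>
    rw [pow_succ, ih]
    ext f
    constructor
    · rintro ⟨_, ⟨a, ha, rfl⟩, _, ⟨b, hb, rfl⟩, rfl⟩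
      exact ⟨a + b, ⟨a, ha, b, hb, rfl⟩, by simp [monomial_mul]⟩
    · rintro ⟨_, ⟨a, ha, b, hb, rfl⟩, rfl⟩
      exact ⟨_, ⟨a, ha, rfl⟩, _, ⟨b, hb, rfl⟩, by simp [monomial_mul]⟩

theorem injective_monomial_one :
    Function.Injective fun m : Fin n →₀ ℕ => (monomial m (1 : k)) :=
  fun _ _ h => monomial_left_injective one_ne_zero h

theorem linearIndepOn_monomialForms (M : Set (Fin n →₀ ℕ)) :
    LinearIndepOn k id (monomialForms k M) := by
  have h : LinearIndependent k fun m : Fin n →₀ ℕ => (monomial m (1 : k)) := by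
    simpa using (basisMonomials (Fin n) k).linearIndependent
  exact (h.linearIndepOn_id).mono (Set.image_subset_range _ _)

theorem ncard_monomialForms (M : Set (Fin n →₀ ℕ)) : (monomialForms k M).ncard = M.ncard :=
  Set.ncard_image_of_injective _ injective_monomial_one

theorem finrank_span_monomialForms {M : Set (Fin n →₀ ℕ)} (hM : M.Finite) :
    Module.finrank k (Submodule.span k (monomialForms k M)) = M.ncard := by
  have := (hM.image fun m : Fin n →₀ ℕ => (monomial m (1 : k))).fintype
  have : Fintype (monomialForms k M) := this
  rw [finrank_span_set_eq_card (linearIndepOn_monomialForms M), ← Set.ncard_eq_toFinset_card',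
    ncard_monomialForms]

theorem hilbertFn_monomialForms {M : Set (Fin n →₀ ℕ)} (hM : M.Finite) (i : ℕ) :
    hilbertFn k (monomialForms k M) i = (sumset M i).ncard := by
  rw [hilbertFn, monomialForms_pow, finrank_span_monomialForms (sumset_finite hM i)]

theorem degree_of_mem_leadingExps {V : Submodule k (MvPolynomial (Fin n) k)} {D : ℕ}
    (hV : ∀ f ∈ V, f.IsHomogeneous D) {d : Fin n →₀ ℕ} (hd : d ∈ leadingExps V) : d.degree = D := by
  obtain ⟨f, hf, h0, rfl⟩ := hd
  by_contra h
  exact (MonomialOrder.coeff_degree_ne_zero_iff.2 h0) ((hV f hf).coeff_eq_zero h)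

theorem isHomogeneous_of_mem_span {W : Set (MvPolynomial (Fin n) k)} {D : ℕ}
    (hW : ∀ f ∈ W, f.IsHomogeneous D) : ∀ f ∈ Submodule.span k W, f.IsHomogeneous D := by
  intro f hf
  have : Submodule.span k W ≤ homogeneousSubmodule (Fin n) k D :=
    Submodule.span_le.2 fun g hg => (mem_homogeneousSubmodule _ _).2 (hW g hg)
  exact (mem_homogeneousSubmodule _ _).1 (this hf)

/-- The Hilbert function of `k[W]` is bounded below by that of the initial monomials of `W`. -/
theorem exists_initial_monomials {D u : ℕ} {W : Set (MvPolynomial (Fin n) k)}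
    (hW : IsFormSet k D u W) :
    ∃ M : Finset (Fin n →₀ ℕ), (∀ m ∈ M, m.degree = D) ∧ M.card = u ∧
      ∀ i, (sumset (M : Set (Fin n →₀ ℕ)) i).ncard ≤ hilbertFn k W i := by
  have : FiniteDimensional k (Submodule.span k W) := FiniteDimensional.span_of_finite k hW.finite
  have hfin := finite_leadingExps (Submodule.span k W)
  refine ⟨hfin.toFinset, fun m hm => ?_, ?_, fun i => ?_⟩
  · exact degree_of_mem_leadingExps (isHomogeneous_of_mem_span hW.homogeneous)
      (hfin.mem_toFinset.1 hm)
  · rw [← Set.ncard_eq_toFinset_card _ hfin, ncard_leadingExps]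
    have := hW.finite.fintype
    rw [finrank_span_set_eq_card hW.linearIndep, ← Set.ncard_eq_toFinset_card', hW.card]
  · rw [hilbertFn_eq_finrank_pow]
    exact ncard_sumset_le_finrank (by simp) i

end InitialMonomials

/-! ### Reduction to strongly stable sets by shears -/

section Compression

open MvPolynomial

variable {k : Type*} [Field k] {n : ℕ}

theorem exists_add_single_eq {m : Fin n →₀ ℕ} {p : Fin n} (hp : m p ≠ 0) :
    ∃ m', Finsupp.single p 1 + m' = m ∧ m'.degree + 1 = m.degree := by
  have hle : Finsupp.single p 1 ≤ m := Finsupp.single_le_iff.2 (Nat.one_le_iff_ne_zero.2 hp)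
  have hadd : Finsupp.single p 1 + (m - Finsupp.single p 1) = m := add_tsub_cancel_of_le hle
  refine ⟨_, hadd, ?_⟩
  have := congrArg Finsupp.degree hadd
  rw [map_add, Finsupp.degree_single] at this
  omega

theorem exists_ne_zero_of_degree_ne_zero {m : Fin n →₀ ℕ} (hm : m.degree ≠ 0) : ∃ p, m p ≠ 0 := by
  by_contra! h
  exact hm ((Finsupp.degree_eq_zero_iff _).2 (Finsupp.ext h))

theorem exists_eq_single_add_single {m : Fin n →₀ ℕ} (hm : m.degree = 2) {p : Fin n}
    (hp : m p ≠ 0) : ∃ q, m = Finsupp.single p 1 + Finsupp.single q 1 := by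
  obtain ⟨m', rfl, hm'⟩ := exists_add_single_eq hp
  obtain ⟨q, hq⟩ := exists_ne_zero_of_degree_ne_zero (m := m') (by omega)
  obtain ⟨m'', rfl, hm''⟩ := exists_add_single_eq hq
  have : m'' = 0 := (Finsupp.degree_eq_zero_iff _).1 (by omega)
  exact ⟨q, by rw [this, add_zero]⟩

theorem exists_pair_of_degree_eq_two {m : Fin n →₀ ℕ} (hm : m.degree = 2) :
    ∃ p q, m = Finsupp.single p 1 + Finsupp.single q 1 := by
  obtain ⟨p, hp⟩ := exists_ne_zero_of_degree_ne_zero (m := m) (by omega)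
  exact ⟨p, exists_eq_single_add_single hm hp⟩

/-- The polynomials all of whose terms are at least `m` in the lexicographic order. -/
def termsGE (k : Type*) [Field k] (m : Fin n →₀ ℕ) : Submodule k (MvPolynomial (Fin n) k) where
  carrier := {f | ∀ d, coeff d f ≠ 0 → toLex m ≤ toLex d}
  zero_mem' := by simp
  add_mem' := by
    intro f g hf hg d hd
    by_cases h : coeff d f = 0
    · refine hg d fun h' => hd ?_
      rw [coeff_add, h, h', add_zero]
    · exact hf d h
  smul_mem' := by
    intro c f hf d hd
    refine hf d fun h => hd ?_
    rw [coeff_smul, h, smul_zero]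

theorem mem_termsGE {m : Fin n →₀ ℕ} {f : MvPolynomial (Fin n) k} :
    f ∈ termsGE k m ↔ ∀ d, coeff d f ≠ 0 → toLex m ≤ toLex d := Iff.rfl

theorem mul_mem_termsGE {m m' : Fin n →₀ ℕ} {f g : MvPolynomial (Fin n) k} (hf : f ∈ termsGE k m)
    (hg : g ∈ termsGE k m') : f * g ∈ termsGE k (m + m') := by
  classical
  rw [mem_termsGE]
  intro d hd
  have := support_mul f g (mem_support_iff.2 hd)
  obtain ⟨a, ha, b, hb, rfl⟩ := Finset.mem_add.1 this
  exact add_le_add (hf a (mem_support_iff.1 ha)) (hg b (mem_support_iff.1 hb))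

theorem termsGE_anti {m m' : Fin n →₀ ℕ} (h : toLex m ≤ toLex m') :
    termsGE k m' ≤ termsGE k m := fun _ hf d hd => h.trans (hf d hd)

theorem X_mem_termsGE (p : Fin n) : (X p : MvPolynomial (Fin n) k) ∈ termsGE k (Finsupp.single p 1) := by
  classical
  intro d hd
  rw [coeff_X] at hd
  by_cases h : Finsupp.single p 1 = d
  · rw [h]
  · simp [h] at hd

theorem degree_X_add_C_mul_X {a b : Fin n} (hba : b < a) {c : k} (hc : c ≠ 0) :
    X a + C c * X b ≠ 0 ∧
      MonomialOrder.lex.degree (X a + C c * X b : MvPolynomial (Fin n) k) = Finsupp.single b 1 := by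
  have hb : MonomialOrder.lex.degree (C c * X b : MvPolynomial (Fin n) k) = Finsupp.single b 1 := by
    rw [MonomialOrder.degree_mul (by simpa using hc) (X_ne_zero b), MonomialOrder.degree_C,
      MonomialOrder.degree_X, zero_add]
  have h : MonomialOrder.lex.degree (X a + C c * X b : MvPolynomial (Fin n) k) =
      Finsupp.single b 1 := by
    rw [MonomialOrder.degree_add_eq_right_of_lt, hb]
    rw [hb, MonomialOrder.degree_X]
    exact MonomialOrder.lex_lt_iff.2 (Finsupp.Lex.single_lt_iff.2 hba)
  refine ⟨fun h0 => ?_, h⟩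
  rw [h0, MonomialOrder.degree_zero] at h
  exact one_ne_zero (Finsupp.single_eq_zero.1 h.symm)

/-- The substitution adding `c` times the variable `b` to the variable `a`. -/
noncomputable def shear (a b : Fin n) (c : k) : MvPolynomial (Fin n) k →ₐ[k] MvPolynomial (Fin n) k :=
  aeval fun q => if q = a then X a + C c * X b else X q

theorem shear_X_self (a b : Fin n) (c : k) : shear a b c (X a) = X a + C c * X b := by
  simp [shear]

theorem shear_X_of_ne {a q : Fin n} (h : q ≠ a) (b : Fin n) (c : k) : shear a b c (X q) = X q := by
  simp [shear, h]

theorem injective_shear {a b : Fin n} (hba : b ≠ a) (c : k) :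
    Function.Injective (shear a b c : MvPolynomial (Fin n) k → MvPolynomial (Fin n) k) := by
  have h : ((shear a b (-c)).comp (shear a b c)) = AlgHom.id k (MvPolynomial (Fin n) k) := by
    refine MvPolynomial.algHom_ext fun q => ?_
    by_cases hq : q = a
    · subst hq
      rw [AlgHom.comp_apply, shear_X_self, map_add, map_mul, shear_X_self, shear_X_of_ne hba,
        ← MvPolynomial.algebraMap_eq, AlgHom.commutes, AlgHom.id_apply, map_neg]
      ring
    · simp [shear_X_of_ne hq]
  exact Function.LeftInverse.injective (g := shear a b (-c)) fun f => AlgHom.congr_fun h f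

/-- An earlier variable is greater in the lexicographic order, so a shear only adds greater terms.
-/
theorem shear_X_mem_termsGE {a b : Fin n} (hba : b < a) (c : k) (q : Fin n) :
    shear a b c (X q) ∈ termsGE k (Finsupp.single q 1) := by
  by_cases hq : q = a
  · subst hq
    rw [shear_X_self]
    refine add_mem (X_mem_termsGE q) ?_
    rw [← smul_eq_C_mul]
    exact Submodule.smul_mem _ _
      (termsGE_anti (Finsupp.Lex.single_lt_iff.2 hba).le (X_mem_termsGE b))
  · rw [shear_X_of_ne hq]
    exact X_mem_termsGE q

theorem monomial_single_add_single (p q : Fin n) :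
    monomial (Finsupp.single p 1 + Finsupp.single q 1) (1 : k) = X p * X q := by
  rw [X, X, monomial_mul, one_mul]

theorem shear_monomial_mem_termsGE {a b : Fin n} (hba : b < a) (c : k) {m : Fin n →₀ ℕ}
    (hm : m.degree = 2) : shear a b c (monomial m 1) ∈ termsGE k m := by
  obtain ⟨p, q, rfl⟩ := exists_pair_of_degree_eq_two hm
  rw [monomial_single_add_single, map_mul]
  exact mul_mem_termsGE (shear_X_mem_termsGE hba c p) (shear_X_mem_termsGE hba c q)

/-- The image under a shear of the span of a set of monomials. -/
noncomputable def shearSpan (a b : Fin n) (c : k) (M : Set (Fin n →₀ ℕ)) :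
    Submodule k (MvPolynomial (Fin n) k) :=
  (Submodule.span k (monomialForms k M)).map (shear a b c).toLinearMap

theorem finiteDimensional_span_monomialForms {M : Set (Fin n →₀ ℕ)} (hM : M.Finite) :
    FiniteDimensional k (Submodule.span k (monomialForms k M)) :=
  FiniteDimensional.span_of_finite k (hM.image _)

theorem finiteDimensional_shearSpan {M : Set (Fin n →₀ ℕ)} (hM : M.Finite) (a b : Fin n) (c : k) :
    FiniteDimensional k (shearSpan a b c M) := by
  have := finiteDimensional_span_monomialForms (k := k) hM
  unfold shearSpan
  infer_instance

theorem finrank_map_shear {a b : Fin n} (hba : b ≠ a) (c : k)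
    (V : Submodule k (MvPolynomial (Fin n) k)) :
    Module.finrank k (V.map (shear a b c).toLinearMap) = Module.finrank k V :=
  (LinearEquiv.finrank_eq (Submodule.equivMapOfInjective _ (injective_shear hba c) V)).symm

theorem ncard_leadingExps_shearSpan {M : Set (Fin n →₀ ℕ)} (hM : M.Finite) {a b : Fin n}
    (hba : b ≠ a) (c : k) : (leadingExps (shearSpan a b c M)).ncard = M.ncard := by
  have := finiteDimensional_shearSpan hM a b c
  rw [ncard_leadingExps, shearSpan, finrank_map_shear hba, finrank_span_monomialForms hM]

theorem ncard_sumset_leadingExps_shearSpan_le {M : Set (Fin n →₀ ℕ)} (hM : M.Finite) {a b : Fin n}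
    (hba : b ≠ a) (c : k) (i : ℕ) :
    (sumset (leadingExps (shearSpan a b c M)) i).ncard ≤ (sumset M i).ncard := by
  have := finiteDimensional_shearSpan hM a b c
  refine (ncard_sumset_le_finrank subset_rfl i).trans ?_
  rw [shearSpan, ← Submodule.map_pow, finrank_map_shear hba, ← hilbertFn_eq_finrank_pow,
    hilbertFn_monomialForms hM]

theorem shear_monomial_mem {M : Set (Fin n →₀ ℕ)} {m : Fin n →₀ ℕ} (hm : m ∈ M) (a b : Fin n)
    (c : k) : shear a b c (monomial m 1) ∈ shearSpan a b c M :=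
  Submodule.mem_map_of_mem (Submodule.subset_span ⟨m, hm, rfl⟩)

theorem isHomogeneous_of_mem_shearSpan {M : Set (Fin n →₀ ℕ)} (hM : ∀ m ∈ M, m.degree = 2)
    (a b : Fin n) (c : k) : ∀ f ∈ shearSpan a b c M, f.IsHomogeneous 2 := by
  have hX : ∀ q, (shear a b c (X q)).IsHomogeneous 1 := fun q => by
    by_cases hq : q = a
    · subst hq
      rw [shear_X_self]
      refine (isHomogeneous_X k q).add ?_
      have := (isHomogeneous_C (Fin n) c).mul (isHomogeneous_X k b)
      rwa [zero_add] at this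
    · rw [shear_X_of_ne hq]
      exact isHomogeneous_X k q
  intro f hf
  have : shearSpan a b c M ≤ homogeneousSubmodule (Fin n) k 2 := by
    rw [shearSpan, Submodule.map_span_le]
    rintro _ ⟨m, hm, rfl⟩
    obtain ⟨p, q, rfl⟩ := exists_pair_of_degree_eq_two (hM m hm)
    rw [mem_homogeneousSubmodule]
    simp only [monomial_single_add_single]
    have := (hX p).mul (hX q)
    simpa using this
  exact (mem_homogeneousSubmodule _ _).1 (this hf)

theorem leadingExps_shearSpan_ge {M : Set (Fin n →₀ ℕ)} (hM : ∀ m ∈ M, m.degree = 2) {a b : Fin n}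
    (hba : b < a) (c : k) {z : Fin n →₀ ℕ} (hz : ∀ m ∈ M, toLex z ≤ toLex m) :
    ∀ d ∈ leadingExps (shearSpan a b c M), toLex z ≤ toLex d := by
  rintro _ ⟨f, hf, h0, rfl⟩
  have : shearSpan a b c M ≤ termsGE k z := by
    rw [shearSpan, Submodule.map_span_le]
    rintro _ ⟨m, hm, rfl⟩
    exact termsGE_anti (hz m hm) (shear_monomial_mem_termsGE hba c (hM m hm))
  exact this hf _ (MonomialOrder.coeff_degree_ne_zero_iff.2 h0)

/-- The image (x_a + x_b) x_q of x_a x_q has leading monomial x_b x_q, unless q = a. In that case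
(x_a + x_b)² leads with x_b²; if this already lies in M, subtracting it leaves (x_a + 2 x_b) x_a,
which leads with x_a x_b as 2 ≠ 0. -/
theorem exists_mem_leadingExps_shearSpan_notMem {M : Set (Fin n →₀ ℕ)} {a b q : Fin n}
    (hba : b < a) (hmem : Finsupp.single a 1 + Finsupp.single q 1 ∈ M)
    (hnot : Finsupp.single b 1 + Finsupp.single q 1 ∉ M) (h2 : (2 : k) ≠ 0) :
    ∃ d ∈ leadingExps (shearSpan a b (1 : k) M), d ∉ M := by
  obtain ⟨h0, hdeg⟩ := degree_X_add_C_mul_X hba (one_ne_zero (α := k))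
  have hm := shear_monomial_mem hmem a b (1 : k)
  rw [monomial_single_add_single, map_mul, shear_X_self] at hm
  by_cases hqa : q = a
  · subst hqa
    rw [shear_X_self] at hm
    by_cases hbb : Finsupp.single b 1 + Finsupp.single b 1 ∈ M
    · have hm' := shear_monomial_mem hbb q b (1 : k)
      rw [monomial_single_add_single, map_mul, shear_X_of_ne hba.ne] at hm'
      obtain ⟨h0', hdeg'⟩ := degree_X_add_C_mul_X hba h2
      refine ⟨_, ⟨_, sub_mem hm hm', ?_, rfl⟩, ?_⟩
      all_goals
        rw [show (X q + C 1 * X b) * (X q + C 1 * X b) - X b * X b =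
          (X q + C 2 * X b) * (X q : MvPolynomial (Fin n) k) by
            rw [map_one, map_ofNat]; ring]
      · exact mul_ne_zero h0' (X_ne_zero q)
      · rwa [MonomialOrder.degree_mul h0' (X_ne_zero q), hdeg', MonomialOrder.degree_X]
    · refine ⟨_, ⟨_, hm, mul_ne_zero h0 h0, rfl⟩, ?_⟩
      rwa [MonomialOrder.degree_mul h0 h0, hdeg]
  · rw [shear_X_of_ne hqa] at hm
    refine ⟨_, ⟨_, hm, mul_ne_zero h0 (X_ne_zero q), rfl⟩, ?_⟩
    rwa [MonomialOrder.degree_mul h0 (X_ne_zero q), hdeg, MonomialOrder.degree_X]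

/-- A set of exponents, in the colexicographic order induced by the lexicographic order. -/
def colexKey (M : Finset (Fin n →₀ ℕ)) : Colex (Finset (Lex (Fin n →₀ ℕ))) :=
  toColex (M.map toLex.toEmbedding)

theorem exists_colex_lt {M : Finset (Fin n →₀ ℕ)} (hM : ∀ m ∈ M, m.degree = 2)
    (hst : ¬ IsStronglyStable 2 (M : Set (Fin n →₀ ℕ))) :
    ∃ M' : Finset (Fin n →₀ ℕ), (∀ m ∈ M', m.degree = 2) ∧ M'.card = M.card ∧
      (∀ i, (sumset (M' : Set (Fin n →₀ ℕ)) i).ncard ≤ (sumset (M : Set (Fin n →₀ ℕ)) i).ncard) ∧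
      colexKey M < colexKey M' := by
  obtain ⟨a, b, q, hba, hmem, hnot⟩ : ∃ a b q, b < a ∧
      Finsupp.single a 1 + Finsupp.single q 1 ∈ M ∧ Finsupp.single b 1 + Finsupp.single q 1 ∉ M := by
    by_contra! hcon
    refine hst ⟨hM, fun m hm i j hi hji => ?_⟩
    obtain ⟨q, rfl⟩ := exists_eq_single_add_single (hM m hm) hi
    rw [add_tsub_cancel_left, add_comm]
    exact hcon i j q hji hm
  have hfinM := M.finite_toSet
  -- The claim concerns sumsets only, so the field is free to choose; ℚ provides 2 ≠ 0.
  have hfd := finiteDimensional_shearSpan hfinM a b (1 : ℚ)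
  have hfin := finite_leadingExps (shearSpan a b (1 : ℚ) (M : Set (Fin n →₀ ℕ)))
  refine ⟨hfin.toFinset, ?_, ?_, ?_, ?_⟩
  · intro m hm
    exact degree_of_mem_leadingExps (isHomogeneous_of_mem_shearSpan hM a b 1)
      (hfin.mem_toFinset.1 hm)
  · rw [← Set.ncard_eq_toFinset_card _ hfin, ncard_leadingExps_shearSpan hfinM hba.ne,
      Set.ncard_coe_finset]
  · intro i
    rw [hfin.coe_toFinset]
    exact ncard_sumset_leadingExps_shearSpan_le hfinM hba.ne 1 i
  · rw [colexKey, colexKey, Finset.Colex.toColex_lt_toColex]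
    constructor
    · intro h
      have h' := Finset.map_injective _ h
      obtain ⟨d, hd, hdM⟩ := exists_mem_leadingExps_shearSpan_notMem (k := ℚ)
        (M := (M : Set (Fin n →₀ ℕ))) hba hmem hnot two_ne_zero
      rw [← hfin.mem_toFinset, ← h'] at hd
      exact hdM hd
    · intro z hz hz'
      obtain ⟨z, hzM, rfl⟩ := Finset.mem_map.1 hz
      have hzM' : z ∉ hfin.toFinset := fun h => hz' (Finset.mem_map_of_mem _ h)
      by_contra! hcon
      -- If no new exponent lies above the lost z, the sheared span of the part U of M from z
      -- upwards has all its leading exponents in U without z: one fewer than its dimension.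
      set U : Finset (Fin n →₀ ℕ) := M.filter fun m => toLex z ≤ toLex m with hU
      have hUM : U ⊆ M := Finset.filter_subset _ _
      have hfdU := finiteDimensional_shearSpan U.finite_toSet a b (1 : ℚ)
      have hsub : leadingExps (shearSpan a b (1 : ℚ) (U : Set (Fin n →₀ ℕ))) ⊆
          ((U.erase z : Finset (Fin n →₀ ℕ)) : Set (Fin n →₀ ℕ)) := by
        intro d hd
        have hge := leadingExps_shearSpan_ge (fun m hm => hM m (hUM hm)) hba (1 : ℚ)
          (fun m hm => (Finset.mem_filter.1 hm).2) d hd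
        have hdM' : d ∈ hfin.toFinset := hfin.mem_toFinset.2 (leadingExps_mono
          (Submodule.map_mono (Submodule.span_mono (Set.image_mono hUM))) hd)
        have hdM : d ∈ M := by
          by_contra hdM
          refine absurd hge (not_le.2 (hcon (toLex d) (Finset.mem_map_of_mem _ hdM') ?_))
          simpa using hdM
        refine Finset.mem_coe.2 (Finset.mem_erase.2 ⟨?_, Finset.mem_filter.2 ⟨hdM, hge⟩⟩)
        rintro rfl
        exact hzM' hdM'
      have h1 := Set.ncard_le_ncard hsub (Finset.finite_toSet _)
      rw [ncard_leadingExps_shearSpan U.finite_toSet hba.ne, Set.ncard_coe_finset,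
        Set.ncard_coe_finset] at h1
      have h2 : (U.erase z).card < U.card :=
        Finset.card_erase_lt_of_mem (Finset.mem_filter.2 ⟨hzM, le_refl (toLex z)⟩)
      omega

theorem finite_degree_eq (n D : ℕ) : {m : Fin n →₀ ℕ | m.degree = D}.Finite := by
  refine ((Finset.finsuppAntidiag (Finset.univ : Finset (Fin n)) D).finite_toSet).subset ?_
  intro m hm
  simpa [Finset.mem_finsuppAntidiag, Finsupp.degree_eq_sum] using hm

/-- Over any field, the Hilbert function of an algebra of quadrics is bounded below by that of the
algebra of a strongly stable set of as many monomials. -/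
theorem exists_isStronglyStable_le {u : ℕ} {W : Set (MvPolynomial (Fin n) k)}
    (hW : IsFormSet k 2 u W) :
    ∃ M : Set (Fin n →₀ ℕ), IsStronglyStable 2 M ∧ M.ncard = u ∧
      ∀ i, hilbertFn k (monomialForms k M) i ≤ hilbertFn k W i := by
  classical
  set C : Set (Finset (Fin n →₀ ℕ)) := {M | (∀ m ∈ M, m.degree = 2) ∧ M.card = u ∧
    ∀ i, (sumset (M : Set (Fin n →₀ ℕ)) i).ncard ≤ hilbertFn k W i} with hC
  have hCfin : C.Finite := by
    refine ((finite_degree_eq n 2).toFinset.powerset.finite_toSet).subset ?_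
    intro M hM
    simp only [Finset.coe_powerset, Set.mem_preimage, Set.mem_powerset_iff]
    intro m hm
    simpa using hM.1 m hm
  obtain ⟨M, hMC, hmax⟩ := Set.exists_max_image C colexKey hCfin (exists_initial_monomials hW)
  refine ⟨M, ?_, ?_, fun i => ?_⟩
  · by_contra hst
    obtain ⟨M', h1, h2, h3, h4⟩ := exists_colex_lt hMC.1 hst
    exact absurd (hmax M' ⟨h1, h2.trans hMC.2.1, fun i => (h3 i).trans (hMC.2.2 i)⟩) (not_le.2 h4)
  · rw [Set.ncard_coe_finset, hMC.2.1]
  · rw [hilbertFn_monomialForms M.finite_toSet]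
    exact hMC.2.2 i

end Compression

/-! ### Products of members of a strongly stable set, and the rows of its complement -/

section StronglyStable

variable {n : ℕ}

/-- The monomial `x_p x_q` belongs to `M`. -/
def HasPair (M : Set (Fin n →₀ ℕ)) (p q : Fin n) : Prop :=
  Finsupp.single p 1 + Finsupp.single q 1 ∈ M

theorem HasPair.symm {M : Set (Fin n →₀ ℕ)} {p q : Fin n} (h : HasPair M p q) : HasPair M q p := by
  rwa [HasPair, add_comm]

theorem HasPair.mono_left {M : Set (Fin n →₀ ℕ)} (hM : IsStronglyStable 2 M) {p p' q : Fin n}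
    (h : HasPair M p q) (hp : p' ≤ p) : HasPair M p' q := by
  rcases hp.eq_or_lt with rfl | hlt
  · exact h
  · have := hM.2 _ h p p' (by simp) hlt
    rwa [add_tsub_cancel_left, add_comm] at this

theorem HasPair.mono {M : Set (Fin n →₀ ℕ)} (hM : IsStronglyStable 2 M) {p p' q q' : Fin n}
    (h : HasPair M p q) (hp : p' ≤ p) (hq : q' ≤ q) : HasPair M p' q' :=
  (((h.mono_left hM hp).symm).mono_left hM hq).symm

theorem sum_single_add_eq (F : Finset (Fin n)) (p q : Fin n) (x : Fin n →₀ ℕ) :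
    ∑ v ∈ F, (Finsupp.single p 1 + (Finsupp.single q 1 + x) : Fin n →₀ ℕ) v =
      (if p ∈ F then 1 else 0) + ((if q ∈ F then 1 else 0) + ∑ v ∈ F, x v) := by
  simp [Finset.sum_add_distrib, Finsupp.single_apply]

open Classical in
/-- A monomial of degree `2 i` is a product of `i` elements of a strongly stable set `M` of quadratic
monomials as soon as, for each variable `p` whose square is not in `M`, the degree in the variables
from `p` on is at most the degree in the variables that can be paired with `p`. -/
theorem mem_sumset_of_sum_le {M : Set (Fin n →₀ ℕ)} (hM : IsStronglyStable 2 M) (i : ℕ) :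
    ∀ x : Fin n →₀ ℕ, x.degree = 2 * i →
      (∀ p, ¬ HasPair M p p → ∑ q with p ≤ q, x q ≤ ∑ q with HasPair M p q, x q) →
      x ∈ sumset M i := by
  induction i with
  | zero =>
    intro x hx _
    exact (Finsupp.degree_eq_zero_iff _).1 (by omega)
  | succ i ih =>
    intro x hx hle
    obtain ⟨p₀, hp₀⟩ := exists_ne_zero_of_degree_ne_zero (m := x) (by omega)
    obtain ⟨p, hp, hpmax⟩ := Finset.exists_max_image x.support id ⟨p₀, by simpa using hp₀⟩
    have hpmax' : ∀ q, p < q → x q = 0 := fun q hq => by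
      by_contra h
      exact absurd (hpmax q (by simpa using h)) (not_le.2 hq)
    obtain ⟨x', rfl, hx'⟩ := exists_add_single_eq (Finsupp.mem_support_iff.1 hp)
    suffices h : ∃ q, HasPair M p q ∧ x' q ≠ 0 by
      obtain ⟨q, hpq, hq⟩ := h
      obtain ⟨y, rfl, hy⟩ := exists_add_single_eq hq
      have hymem : y ∈ sumset M i := by
        -- Removing x_p x_q preserves the inequalities. Beyond p the tail is empty. For p' ≤ p the
        -- left side loses p, while the right side loses at most q: were p paired with p', the
        -- square of p' would be in M.
        refine ih y (by omega) fun p' hp' => ?_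
        have h := hle p' hp'
        rw [sum_single_add_eq, sum_single_add_eq] at h
        by_cases hpp' : p < p'
        · have : ∑ q with p' ≤ q, y q = 0 := by
            refine Finset.sum_eq_zero fun v hv => ?_
            have := hpmax' v (hpp'.trans_le (Finset.mem_filter.1 hv).2)
            simp only [Finsupp.add_apply] at this
            omega
          omega
        · have hle' : p' ≤ p := not_lt.1 hpp'
          have h1 : ¬ HasPair M p' p := fun h => hp' (h.mono hM le_rfl hle')
          simp only [mem_filter, mem_univ, true_and, hle', if_true, h1, if_false] at h
          split_ifs at h <;> omega
      refine ⟨y, hymem, _, hpq, ?_⟩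
      exact (add_comm y _).trans (add_assoc _ _ _)
    by_cases hpp : HasPair M p p
    · obtain ⟨q, hq⟩ := exists_ne_zero_of_degree_ne_zero (m := x') (by omega)
      refine ⟨q, hpp.mono hM le_rfl ?_, hq⟩
      by_contra hlt
      have := hpmax' q (not_le.1 hlt)
      simp only [Finsupp.add_apply] at this
      omega
    -- The inequality at p itself provides a partner, as its left side is positive.
    · have h := hle p hpp
      have hpos : 0 < ∑ q with p ≤ q, (Finsupp.single p 1 + x' : Fin n →₀ ℕ) q :=
        Finset.sum_pos' (fun _ _ => Nat.zero_le _) ⟨p, by simp, by simp⟩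
      obtain ⟨q, hq, hq0⟩ := Finset.exists_ne_zero_of_sum_ne_zero (hpos.trans_le h).ne'
      have hq := (Finset.mem_filter.1 hq).2
      have hqp : p ≠ q := by
        rintro rfl
        exact hpp hq
      refine ⟨q, hq, ?_⟩
      simpa [Finsupp.single_apply, hqp] using hq0

/-- The number of variables `x_q`, `q ≤ p`, with `x_p x_q ∉ M`, where `p` is the variable with exactly
`j` later variables (and `0` if there is no such `p`). -/
noncomputable def rowLen (M : Set (Fin n →₀ ℕ)) (j : ℕ) : ℕ :=
  {q : Fin n | ∃ p : Fin n, p.val + j + 1 = n ∧ q ≤ p ∧ ¬ HasPair M p q}.ncard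

theorem rowLen_eq (M : Set (Fin n →₀ ℕ)) {p : Fin n} {j : ℕ} (hp : p.val + j + 1 = n) :
    rowLen M j = {q : Fin n | q ≤ p ∧ ¬ HasPair M p q}.ncard := by
  refine congrArg Set.ncard (Set.ext fun q => ⟨?_, fun h => ⟨p, hp, h⟩⟩)
  rintro ⟨p', hp', h⟩
  obtain rfl : p' = p := Fin.ext (by omega)
  exact h

theorem exists_of_rowLen_pos {M : Set (Fin n →₀ ℕ)} {j : ℕ} (h : 0 < rowLen M j) :
    ∃ p : Fin n, p.val + j + 1 = n := by
  obtain ⟨q, p, hp, -⟩ := (Set.ncard_pos (Set.toFinite _)).1 h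
  exact ⟨p, hp⟩

theorem rowLen_pos_iff {M : Set (Fin n →₀ ℕ)} (hM : IsStronglyStable 2 M) {p : Fin n} {j : ℕ}
    (hp : p.val + j + 1 = n) : 0 < rowLen M j ↔ ¬ HasPair M p p := by
  rw [rowLen_eq M hp, Set.ncard_pos (Set.toFinite _)]
  exact ⟨fun ⟨q, hq, h⟩ hpp => h (hpp.mono hM le_rfl hq), fun h => ⟨p, le_rfl, h⟩⟩

theorem hasPair_iff_of_rowLen_pos {M : Set (Fin n →₀ ℕ)} (hM : IsStronglyStable 2 M) {p q : Fin n}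
    {j : ℕ} (hp : p.val + j + 1 = n) (hj : 0 < rowLen M j) :
    HasPair M p q ↔ q.val + (j + rowLen M j) < n := by
  have hpp := (rowLen_pos_iff hM hp).1 hj
  rw [rowLen_eq M hp]
  constructor
  · intro h
    have hqp : q < p := by
      by_contra hle
      exact hpp (h.mono hM le_rfl (not_lt.1 hle))
    have hsub : {q : Fin n | q ≤ p ∧ ¬ HasPair M p q} ⊆ (Finset.Ioc q p : Finset (Fin n)) := by
      rintro v ⟨hv, hv'⟩
      rw [Finset.coe_Ioc]
      refine ⟨?_, hv⟩
      by_contra hle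
      exact hv' (h.mono hM le_rfl (not_lt.1 hle))
    have := Set.ncard_le_ncard hsub (Finset.finite_toSet _)
    rw [Set.ncard_coe_finset, Fin.card_Ioc] at this
    have : q.val < p.val := hqp
    omega
  · intro h
    by_contra hnot
    rcases le_or_gt q p with hqp | hqp
    · have hsub : ((Finset.Icc q p : Finset (Fin n)) : Set (Fin n)) ⊆
          {q : Fin n | q ≤ p ∧ ¬ HasPair M p q} := by
        intro v hv
        rw [Finset.coe_Icc] at hv
        exact ⟨hv.2, fun h' => hnot (h'.mono hM le_rfl hv.1)⟩
      have := Set.ncard_le_ncard hsub (Set.toFinite _)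
      rw [Set.ncard_coe_finset, Fin.card_Icc] at this
      have : q.val ≤ p.val := hqp
      omega
    · have : p.val < q.val := hqp
      omega

/-- The row of a variable is contained in the row of the next variable, which has that next variable
as an additional element. -/
theorem rowLen_succ_lt {M : Set (Fin n →₀ ℕ)} (hM : IsStronglyStable 2 M) {j : ℕ}
    (hj : 0 < rowLen M (j + 1)) : rowLen M (j + 1) < rowLen M j := by
  obtain ⟨p, hp⟩ := exists_of_rowLen_pos hj
  obtain ⟨p', hp'⟩ : ∃ p' : Fin n, p'.val = p.val + 1 := ⟨⟨p.val + 1, by omega⟩, rfl⟩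
  have hlt : p < p' := Fin.lt_def.2 (by omega)
  have hpp := (rowLen_pos_iff hM hp).1 hj
  rw [rowLen_eq M hp, rowLen_eq M (show p'.val + j + 1 = n by omega)]
  refine Set.ncard_lt_ncard ⟨?_, fun hsub => ?_⟩ (Set.toFinite _)
  · rintro q ⟨hq, hq'⟩
    exact ⟨hq.trans hlt.le, fun h => hq' (h.mono hM hlt.le le_rfl)⟩
  · have : p' ∈ {q : Fin n | q ≤ p' ∧ ¬ HasPair M p' q} :=
      ⟨le_rfl, fun h => hpp (h.mono hM hlt.le hlt.le)⟩
    exact absurd (hsub this).1 (not_le.2 hlt)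

theorem card_pairs_le (n : ℕ) :
    ({p : Fin n × Fin n | p.1 ≤ p.2} : Finset (Fin n × Fin n)).card = (n + 1).choose 2 := by
  have h1 : ({p : Fin n × Fin n | p.1 ≤ p.2} : Finset (Fin n × Fin n)).card =
      ∑ q : Fin n, (q.val + 1) := by
    rw [Finset.card_filter, ← Finset.univ_product_univ, Finset.sum_product_right]
    refine Finset.sum_congr rfl fun q _ => ?_
    rw [← Finset.card_filter, ← Fin.card_Iic q]
    congr 1
    ext v
    simp
  rw [h1, Fin.sum_univ_eq_sum_range (fun j => j + 1)]
  clear h1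
  induction n with
  | zero => rfl
  | succ n ih =>
    rw [Finset.sum_range_succ, ih, Nat.choose_succ_succ' (n + 1) 1, Nat.choose_one_right, add_comm]

/-- The exponent vector of `x_p x_q`. -/
noncomputable def pairExp (p : Fin n × Fin n) : Fin n →₀ ℕ :=
  Finsupp.single p.1 1 + Finsupp.single p.2 1

theorem pairExp_injOn : Set.InjOn (pairExp (n := n)) {p | p.1 ≤ p.2} := by
  rintro ⟨a, b⟩ hab ⟨c, d⟩ hcd h
  simp only [Set.mem_ofPred_eq] at hab hcd
  rcases (Finsupp.single_add_single_eq_single_add_single one_ne_zero one_ne_zero).1 h with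
    ⟨rfl, rfl⟩ | ⟨-, rfl, rfl⟩ | ⟨h, -⟩
  · rfl
  · rw [le_antisymm hab hcd]
  · exact absurd h (by norm_num)

theorem exists_pairExp_eq {m : Fin n →₀ ℕ} (hm : m.degree = 2) :
    ∃ p : Fin n × Fin n, p.1 ≤ p.2 ∧ pairExp p = m := by
  obtain ⟨p, q, rfl⟩ := exists_pair_of_degree_eq_two hm
  rcases le_total p q with h | h
  · exact ⟨(p, q), h, rfl⟩
  · exact ⟨(q, p), h, add_comm _ _⟩

theorem degree_pairExp (p : Fin n × Fin n) : (pairExp p).degree = 2 := by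
  simp [pairExp, Finsupp.degree_single]

open Classical in
theorem ncard_eq_card_pairs {M : Set (Fin n →₀ ℕ)} (hM : ∀ m ∈ M, m.degree = 2) :
    M.ncard =
      ({p : Fin n × Fin n | p.1 ≤ p.2 ∧ HasPair M p.1 p.2} : Finset (Fin n × Fin n)).card := by
  have : M = pairExp '' {p : Fin n × Fin n | p.1 ≤ p.2 ∧ HasPair M p.1 p.2} := by
    ext m
    constructor
    · intro hm
      obtain ⟨p, hp, rfl⟩ := exists_pairExp_eq (hM m hm)
      exact ⟨p, ⟨hp, hm⟩, rfl⟩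
    · rintro ⟨p, ⟨-, hp⟩, rfl⟩
      exact hp
  rw [← Set.ncard_coe_finset, Finset.coe_filter]
  conv_lhs => rw [this]
  rw [(pairExp_injOn.mono fun p hp => hp.1).ncard_image]
  simp

theorem ncard_add_sum_rowLen {M : Set (Fin n →₀ ℕ)} (hM : ∀ m ∈ M, m.degree = 2) :
    M.ncard + ∑ j ∈ range n, rowLen M j = (n + 1).choose 2 := by
  classical
  have h1 : ∑ j ∈ range n, rowLen M j =
      ({p : Fin n × Fin n | p.1 ≤ p.2 ∧ ¬ HasPair M p.1 p.2} : Finset (Fin n × Fin n)).card := by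
    rw [← Fin.sum_univ_eq_sum_range, ← Equiv.sum_comp Fin.revPerm, Finset.card_filter,
      ← Finset.univ_product_univ, Finset.sum_product_right]
    refine Finset.sum_congr rfl fun p _ => ?_
    have hp : p.val + (Fin.rev p).val + 1 = n := by
      rw [Fin.val_rev]
      omega
    rw [Fin.revPerm_apply, rowLen_eq M hp, ← Finset.card_filter, ← Set.ncard_coe_finset]
    congr 1
    ext q
    simp only [Set.mem_ofPred_eq, coe_filter, mem_univ, true_and]
    exact and_congr_right fun _ => not_congr ⟨HasPair.symm, HasPair.symm⟩
  rw [h1, ncard_eq_card_pairs hM, ← card_pairs_le n, ← Finset.filter_filter, ← Finset.filter_filter]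
  exact Finset.card_filter_add_card_filter_not _

end StronglyStable

/-! ### The set Lex(u) and the monomials it misses -/

section LexSegment

variable {n : ℕ}

/-- Induction by adding a new maximum: it has all of T below it and changes no count below the other
elements. -/
theorem card_filter_card_lt {α : Type*} [LinearOrder α] (T : Finset α) (u : ℕ) :
    (T.filter fun p => (T.filter fun q => q < p).card < u).card = min u T.card := by
  induction T using Finset.induction_on_max with
  | empty => simp
  | insert a T ha ih =>
    have haT : a ∉ T := fun h => lt_irrefl _ (ha a h)
    have h1 : (insert a T).filter (fun q => q < a) = T := by
      ext q
      simp only [mem_filter, mem_insert]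
      constructor
      · rintro ⟨rfl | h, h'⟩
        · exact absurd h' (lt_irrefl _)
        · exact h
      · exact fun h => ⟨Or.inr h, ha q h⟩
    have h2 : T.filter (fun p => ((insert a T).filter fun q => q < p).card < u) =
        T.filter fun p => (T.filter fun q => q < p).card < u := by
      refine Finset.filter_congr fun p hp => ?_
      rw [Finset.filter_insert, if_neg (not_lt.2 (ha p hp).le)]
    rw [Finset.filter_insert, h1, h2]
    split_ifs with h
    · rw [card_insert_of_notMem (fun h => haT (mem_filter.1 h).1), ih, card_insert_of_notMem haT]
      omega
    · rw [ih, card_insert_of_notMem haT]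
      omega

theorem lexGT_iff {p q : Fin n × Fin n} : LexGT q p ↔ toLex q < toLex p := by
  rw [Prod.Lex.lt_iff]
  rfl

theorem ncard_lexPairs {u : ℕ} (hu : u ≤ (n + 1).choose 2) : (lexPairs n u).ncard = u := by
  classical
  set T : Finset (Fin n × Fin n) := {p : Fin n × Fin n | p.1 ≤ p.2} with hT
  have h : (lexPairs n u) = ofLex '' (((T.map toLex.toEmbedding).filter fun p =>
      ((T.map toLex.toEmbedding).filter fun q => q < p).card < u : Finset _) :
      Set (Lex (Fin n × Fin n))) := by
    have hcard : ∀ p : Fin n × Fin n, ((T.map toLex.toEmbedding).filter fun q => q < toLex p).card =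
        {q : Fin n × Fin n | q.1 ≤ q.2 ∧ LexGT q p}.ncard := by
      intro p
      rw [Finset.filter_map, Finset.card_map, ← Set.ncard_coe_finset]
      congr 1
      ext q
      simp [hT, lexGT_iff]
    ext p
    constructor
    · rintro ⟨hp, hlt⟩
      refine ⟨toLex p, ?_, rfl⟩
      rw [Finset.mem_coe, Finset.mem_filter, hcard]
      exact ⟨Finset.mem_map_of_mem _ (by simpa [hT] using hp), hlt⟩
    · rintro ⟨p, hp, rfl⟩
      rw [Finset.mem_coe, Finset.mem_filter] at hp
      obtain ⟨hp, hlt⟩ := hp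
      obtain ⟨p, hp', rfl⟩ := Finset.mem_map.1 hp
      refine ⟨by simpa [hT] using hp', ?_⟩
      rw [← hcard]
      exact hlt
  rw [h, Set.ncard_image_of_injective _ ofLex.injective, Set.ncard_coe_finset, card_filter_card_lt,
    Finset.card_map, hT, card_pairs_le, min_eq_left hu]

/-- The exponent vectors of the members of `Lex(u)`. -/
def lexExps (n u : ℕ) : Set (Fin n →₀ ℕ) := pairExp '' lexPairs n u

theorem lexForms_eq (k : Type*) [Field k] (n u : ℕ) :
    lexForms k n u = monomialForms k (lexExps n u) := by
  rw [lexForms, monomialForms, lexExps, Set.image_image]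
  exact Set.image_congr fun p _ => (monomial_single_add_single p.1 p.2).symm

theorem ncard_lexExps {u : ℕ} (hu : u ≤ (n + 1).choose 2) : (lexExps n u).ncard = u := by
  rw [lexExps, (pairExp_injOn.mono fun p hp => hp.1).ncard_image, ncard_lexPairs hu]

theorem isFormSet_lexForms (k : Type*) [Field k] {u : ℕ} (hu : u ≤ (n + 1).choose 2) :
    IsFormSet k 2 u (lexForms k n u) where
  finite := (Set.toFinite (lexPairs n u)).image _
  card := by rw [lexForms_eq, ncard_monomialForms, ncard_lexExps hu]
  homogeneous := by
    rintro _ ⟨p, -, rfl⟩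
    exact (MvPolynomial.isHomogeneous_X k p.1).mul (MvPolynomial.isHomogeneous_X k p.2)
  linearIndep := by
    rw [lexForms_eq]
    exact linearIndepOn_monomialForms _

theorem lexPairs_of_le {u : ℕ} {p p' : Fin n × Fin n} (hp : p ∈ lexPairs n u) (h' : p'.1 ≤ p'.2)
    (hle : toLex p' ≤ toLex p) : p' ∈ lexPairs n u := by
  refine ⟨h', lt_of_le_of_lt (Set.ncard_le_ncard ?_ (Set.toFinite _)) hp.2⟩
  rintro q ⟨hq, hlt⟩
  exact ⟨hq, lexGT_iff.2 ((lexGT_iff.1 hlt).trans_le hle)⟩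

theorem isStronglyStable_lexExps (n u : ℕ) : IsStronglyStable 2 (lexExps n u) := by
  refine ⟨?_, ?_⟩
  · rintro _ ⟨p, -, rfl⟩
    exact degree_pairExp p
  · rintro _ ⟨⟨a, b⟩, hp, rfl⟩ i j hi hji
    have hab : a ≤ b := hp.1
    obtain ⟨q, hq⟩ := exists_eq_single_add_single (degree_pairExp (a, b)) hi
    rw [hq, add_tsub_cancel_left]
    rcases (Finsupp.single_add_single_eq_single_add_single one_ne_zero one_ne_zero).1 hq with
      ⟨rfl, rfl⟩ | ⟨-, rfl, rfl⟩ | ⟨h, -⟩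
    · refine ⟨(j, b), lexPairs_of_le hp (hji.le.trans hab) ?_, add_comm _ _⟩
      exact le_of_lt (lexGT_iff.1 (Or.inl hji))
    · rcases le_total a j with h | h
      · refine ⟨(a, j), lexPairs_of_le hp h ?_, rfl⟩
        exact le_of_lt (lexGT_iff.1 (Or.inr ⟨rfl, hji⟩))
      · refine ⟨(j, a), lexPairs_of_le hp h ?_, add_comm _ _⟩
        rcases h.eq_or_lt with rfl | h
        · exact le_of_lt (lexGT_iff.1 (Or.inr ⟨rfl, hji⟩))
        · exact le_of_lt (lexGT_iff.1 (Or.inl h))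
    · exact absurd h (by norm_num)

theorem hasPair_lexExps_iff {u : ℕ} {a b : Fin n} (hab : a ≤ b) :
    HasPair (lexExps n u) a b ↔ (a, b) ∈ lexPairs n u := by
  constructor
  · rintro ⟨p, hp, h⟩
    obtain rfl : p = (a, b) := pairExp_injOn hp.1 hab h
    exact hp
  · exact fun h => ⟨_, h, rfl⟩

/-- A monomial `x_a x_b` such that at most `s` monomials are not greater than it does not belong to
`Lex(u)`, for `u` the number of all quadratic monomials minus `s`. -/
theorem not_hasPair_lexExps {u s : ℕ} (hu : u + s = (n + 1).choose 2) {a b : Fin n} (hab : a ≤ b)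
    {S : Finset (Fin n × Fin n)} (hS : S.card ≤ s)
    (h : ∀ q : Fin n × Fin n, q.1 ≤ q.2 → (a < q.1 ∨ a = q.1 ∧ b ≤ q.2) → q ∈ S) :
    ¬ HasPair (lexExps n u) a b := by
  classical
  rw [hasPair_lexExps_iff hab]
  rintro ⟨-, hlt⟩
  have hsub : (({p : Fin n × Fin n | p.1 ≤ p.2} : Finset (Fin n × Fin n)) \ S : Finset _) ⊆
      ({q : Fin n × Fin n | q.1 ≤ q.2 ∧ LexGT q (a, b)} : Finset _) := by
    intro q hq
    simp only [mem_sdiff, mem_filter, mem_univ, true_and] at hq ⊢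
    refine ⟨hq.1, ?_⟩
    rw [lexGT_iff]
    by_contra hcon
    refine hq.2 (h q hq.1 ?_)
    rcases (not_lt.1 hcon).lt_or_eq with h' | h'
    · rcases Prod.Lex.lt_iff.1 h' with h' | h'
      · exact Or.inl h'
      · exact Or.inr ⟨h'.1, h'.2.le⟩
    · have h' : (a, b) = q := toLex.injective h'
      subst h'
      exact Or.inr ⟨rfl, le_rfl⟩
  have h1 := Finset.card_le_card hsub
  have h2 := Finset.le_card_sdiff S ({p : Fin n × Fin n | p.1 ≤ p.2} : Finset (Fin n × Fin n))
  rw [card_pairs_le] at h2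
  have h3 : ({q : Fin n × Fin n | q.1 ≤ q.2 ∧ LexGT q (a, b)} : Finset _).card =
      {q : Fin n × Fin n | q.1 ≤ q.2 ∧ LexGT q (a, b)}.ncard := by
    rw [← Set.ncard_coe_finset, coe_filter]
    simp
  omega

theorem card_pairs_ge (n r : ℕ) :
    ({q : Fin n × Fin n | q.1 ≤ q.2 ∧ n ≤ q.1.val + r} : Finset _).card ≤ (r + 1).choose 2 := by
  rw [← card_pairs_le r]
  rcases Nat.eq_zero_or_pos r with rfl | hr
  · refine (Finset.card_eq_zero.2 (Finset.filter_eq_empty_iff.2 fun q _ hq => ?_)).le.trans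
      (Nat.zero_le _)
    omega
  refine Finset.card_le_card_of_injOn
    -- Reversing the order of the variables carries the last r to the first r; the minima only keep
    -- the indices in range elsewhere.
    (fun q => (⟨min (n - 1 - q.2.val) (r - 1), by omega⟩, ⟨min (n - 1 - q.1.val) (r - 1), by omega⟩))
    ?_ ?_
  · rintro ⟨a, b⟩ hq
    simp only [coe_filter, mem_univ, true_and, Set.mem_ofPred_eq, Fin.le_def] at hq ⊢
    omega
  · rintro ⟨a, b⟩ hq ⟨c, d⟩ hq' heq
    simp only [coe_filter, mem_univ, true_and, Set.mem_ofPred_eq, Fin.le_def] at hq hq'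
    simp only [Prod.mk.injEq, Fin.mk.injEq] at heq
    rw [Prod.mk.injEq]
    exact ⟨Fin.ext (by omega), Fin.ext (by omega)⟩

/-- Stability reduces the claim to the greatest such monomial, the square of the variable with index
n - r. Only the (r+1).choose 2 monomials in the last r variables are not greater than it. -/
theorem not_hasPair_lexExps_of_ge {u s r : ℕ} (hu : u + s = (n + 1).choose 2)
    (hs : (r + 1).choose 2 ≤ s) (hr : r ≤ n) {a b : Fin n} (ha : n ≤ a.val + r)
    (hb : n ≤ b.val + r) : ¬ HasPair (lexExps n u) a b := by
  intro h
  have hlt : n - r < n := by omega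
  have h' : HasPair (lexExps n u) ⟨n - r, hlt⟩ ⟨n - r, hlt⟩ :=
    h.mono (isStronglyStable_lexExps n u) (Fin.le_def.2 (by simp; omega))
      (Fin.le_def.2 (by simp; omega))
  refine not_hasPair_lexExps hu le_rfl ((card_pairs_ge n r).trans hs) (fun q hq hq' => ?_) h'
  simp only [Fin.lt_def, Fin.ext_iff] at hq'
  simp only [mem_filter, mem_univ, true_and]
  exact ⟨hq, by omega⟩

/-- Same reduction: besides the triangle on the last r variables, only the t products of the
preceding variable with the last t count. -/
theorem not_hasPair_lexExps_of_ge_of_ge {u s r t : ℕ} (hu : u + s = (n + 1).choose 2)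
    (hs : (r + 1).choose 2 + t ≤ s) (hr : r < n) (htr : t ≤ r) {a b : Fin n}
    (ha : n ≤ a.val + r + 1) (hb : n ≤ b.val + t) : ¬ HasPair (lexExps n u) a b := by
  intro h
  have hlt : n - r - 1 < n := by omega
  have hlt' : n - t < n := by omega
  have h' : HasPair (lexExps n u) ⟨n - r - 1, hlt⟩ ⟨n - t, hlt'⟩ :=
    h.mono (isStronglyStable_lexExps n u) (Fin.le_def.2 (by simp; omega))
      (Fin.le_def.2 (by simp; omega))
  refine not_hasPair_lexExps (S := ({q : Fin n × Fin n | q.1 ≤ q.2 ∧ n ≤ q.1.val + r} : Finset _) ∪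
    ((univ.filter fun b : Fin n => n ≤ b.val + t).image fun b => (⟨n - r - 1, hlt⟩, b)))
    hu (Fin.le_def.2 (by simp; omega)) ?_ (fun q hq hq' => ?_) h'
  · refine (Finset.card_union_le _ _).trans ((Nat.add_le_add (card_pairs_ge n r) ?_).trans hs)
    refine Finset.card_image_le.trans ?_
    have : (univ.filter fun b : Fin n => n ≤ b.val + t).card ≤ (range t).card := by
      refine Finset.card_le_card_of_injOn (fun b => n - 1 - b.val) ?_ ?_
      · intro b hb
        simp only [coe_filter, mem_univ, true_and, Set.mem_ofPred_eq] at hb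
        simp only [coe_range, Set.mem_Iio]
        omega
      · intro b hb c hc heq
        simp only at heq
        exact Fin.ext (by omega)
    simpa using this
  · simp only [Fin.lt_def, Fin.ext_iff, Fin.le_def] at hq' hq
    simp only [mem_union, mem_filter, mem_univ, true_and, mem_image]
    by_cases h : n ≤ q.1.val + r
    · exact Or.inl ⟨hq, h⟩
    · refine Or.inr ⟨q.2, by omega, Prod.ext (Fin.ext ?_) rfl⟩
      simp only
      omega

end LexSegment

/-! ### Bounded shifts of degree are asymptotically negligible -/

section Asymptotics

/-- The number of monomials of degree `D` in `n` variables. -/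
noncomputable def numMonomials (n D : ℕ) : ℕ :=
  (degreeSlice (ι := Fin n) (fun _ => True) D).card

theorem numMonomials_eq {n : ℕ} (D : ℕ) : numMonomials (n + 1) D = (n + D).choose D := by
  have : degreeSlice (ι := Fin (n + 1)) (fun _ => True) D = finsuppAntidiag univ D := by
    ext x
    simp [mem_degreeSlice, mem_finsuppAntidiag]
  rw [numMonomials, this, card_finsuppAntidiag_nat_eq_choose]
  simp [add_right_comm]

theorem monotone_numMonomials (n : ℕ) : Monotone (numMonomials (n + 1)) :=
  monotone_card_degreeSlice (K := univ) (fun _ _ _ _ => trivial) univ_nonempty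

theorem numMonomials_succ_mul (n D : ℕ) :
    numMonomials (n + 1) (D + 1) * (D + 1) = numMonomials (n + 1) D * (n + D + 1) := by
  rw [numMonomials_eq, numMonomials_eq, ← add_assoc, mul_comm _ (n + D + 1)]
  exact (Nat.add_one_mul_choose_eq (n + D) D).symm

theorem numMonomials_pos (n D : ℕ) : 0 < numMonomials (n + 1) D := by
  rw [numMonomials_eq]
  exact Nat.choose_pos (by omega)

open Filter Topology

theorem tendsto_numMonomials_ratio (n a : ℕ) :
    Tendsto (fun D => (numMonomials (n + 1) (D + a) : ℝ) / numMonomials (n + 1) D) atTop (𝓝 1) := by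
  have hpos : ∀ D, (0 : ℝ) < numMonomials (n + 1) D := fun D => by
    exact_mod_cast numMonomials_pos n D
  have h1 : Tendsto (fun D => (numMonomials (n + 1) (D + 1) : ℝ) / numMonomials (n + 1) D) atTop
      (𝓝 1) := by
    have h : ∀ D : ℕ, (numMonomials (n + 1) (D + 1) : ℝ) / numMonomials (n + 1) D =
        1 + n * (1 / ((D : ℝ) + 1)) := by
      intro D
      have h2 : (numMonomials (n + 1) (D + 1) : ℝ) * (D + 1) =
          numMonomials (n + 1) D * (n + D + 1) := by exact_mod_cast numMonomials_succ_mul n D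
      have h3 := hpos D
      have h4 : (0 : ℝ) < D + 1 := by positivity
      field_simp
      linarith
    simp_rw [h]
    simpa using (tendsto_one_div_add_atTop_nhds_zero_nat (𝕜 := ℝ)).const_mul (n : ℝ) |>.const_add 1
  induction a with
  | zero =>
    refine tendsto_const_nhds.congr fun D => ?_
    rw [add_zero, div_self (hpos D).ne']
  | succ a ih =>
    have h2 := (h1.comp (tendsto_add_atTop_nat a)).mul ih
    rw [one_mul] at h2
    refine h2.congr fun D => ?_
    have h3 := hpos D
    have h4 := hpos (D + a)
    simp only [Function.comp_apply, ← add_assoc]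
    field_simp

/-- The ratio of the counts in degrees D + a and D tends to 1, so a strict inequality between
coefficients absorbs the shift. -/
theorem eventually_mul_numMonomials_le {K₁ K₂ : ℕ} (h : K₁ < K₂) (n a : ℕ) :
    ∀ᶠ D in atTop, K₁ * numMonomials (n + 1) (D + a) ≤ K₂ * numMonomials (n + 1) D := by
  have h1 := (tendsto_numMonomials_ratio n a).const_mul (K₁ : ℝ)
  rw [mul_one] at h1
  have h2 : (K₁ : ℝ) < K₂ := by exact_mod_cast h
  filter_upwards [h1.eventually_lt_const h2] with D hD
  have hpos : (0 : ℝ) < numMonomials (n + 1) D := by exact_mod_cast numMonomials_pos n D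
  rw [← mul_div_assoc, div_lt_iff₀ hpos] at hD
  exact_mod_cast hD.le

/-- If `K₁ < K₂`, then `K₁` times the number of monomials of degree `2 i + a` is eventually at most
`K₂` times the number of monomials of degree `2 i - b`. -/
theorem eventually_mul_numMonomials_two_mul_le {K₁ K₂ : ℕ} (h : K₁ < K₂) (n a b : ℕ) :
    ∀ᶠ i in atTop, b ≤ 2 * i ∧
      K₁ * numMonomials (n + 1) (2 * i + a) ≤ K₂ * numMonomials (n + 1) (2 * i - b) := by
  have h1 : Tendsto (fun i : ℕ => 2 * i - b) atTop atTop :=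
    tendsto_atTop_mono (fun i => by omega : ∀ i, i - b ≤ 2 * i - b) (tendsto_sub_atTop_nat b)
  filter_upwards [h1.eventually (eventually_mul_numMonomials_le h n (a + b)),
    eventually_ge_atTop b] with i hi hb
  refine ⟨by omega, ?_⟩
  rwa [show 2 * i - b + (a + b) = 2 * i + a by omega] at hi

end Asymptotics

/-! ### Gaps and tail regions -/

section Gaps

variable {n : ℕ}

/-- The exponent vectors of degree `2 i` that are not sums of `i` elements of `M`. -/
noncomputable def gaps (M : Set (Fin n →₀ ℕ)) (i : ℕ) : Finset (Fin n →₀ ℕ) :=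
  degreeSlice (fun x => x ∉ sumset M i) (2 * i)

theorem degree_of_mem_sumset {M : Set (Fin n →₀ ℕ)} (hM : ∀ m ∈ M, m.degree = 2) (i : ℕ) :
    ∀ x ∈ sumset M i, x.degree = 2 * i := by
  induction i with
  | zero =>
    rintro x rfl
    simp
  | succ i ih =>
    rintro _ ⟨a, ha, b, hb, rfl⟩
    simp only [map_add, ih a ha, hM b hb]
    ring

theorem ncard_sumset_add_card_gaps {M : Set (Fin n →₀ ℕ)} (hM : ∀ m ∈ M, m.degree = 2) (i : ℕ) :
    (sumset M i).ncard + (gaps M i).card = numMonomials n (2 * i) := by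
  classical
  have h1 : (sumset M i).ncard = (degreeSlice (fun x => x ∈ sumset M i) (2 * i)).card := by
    rw [← Set.ncard_coe_finset]
    congr 1
    ext x
    rw [mem_coe, mem_degreeSlice, ← Finsupp.degree_eq_sum]
    exact ⟨fun h => ⟨degree_of_mem_sumset hM i x h, h⟩, fun h => h.2⟩
  rw [h1, gaps, numMonomials]
  have h2 := Finset.card_filter_add_card_filter_not
    (s := degreeSlice (ι := Fin n) (fun _ => True) (2 * i)) (fun x => x ∈ sumset M i)
  rw [← h2]
  congr 2 <;> ext x <;> simp [mem_degreeSlice]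

/-- The last `a` variables. -/
def lastVars (n a : ℕ) : Finset (Fin n) := {q | n ≤ q.val + a}

/-- The first `c` variables. -/
def firstVars (n c : ℕ) : Finset (Fin n) := {q | q.val < c}

theorem mem_lastVars {a : ℕ} {q : Fin n} : q ∈ lastVars n a ↔ n ≤ q.val + a := by simp [lastVars]

theorem mem_firstVars {c : ℕ} {q : Fin n} : q ∈ firstVars n c ↔ q.val < c := by simp [firstVars]

theorem card_firstVars {c : ℕ} (hc : c ≤ n) : (firstVars n c).card = c := by
  simp [firstVars, Fin.card_filter_val_lt, hc]

theorem card_lastVars {a : ℕ} (ha : a ≤ n) : (lastVars n a).card = a := by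
  have h := Finset.card_compl (firstVars n (n - a))
  rw [card_firstVars (Nat.sub_le _ _), Fintype.card_fin] at h
  have : (firstVars n (n - a))ᶜ = lastVars n a := by
    ext q
    rw [mem_compl, mem_firstVars, mem_lastVars]
    omega
  rw [← this, h]
  omega

theorem disjoint_last_first {a c : ℕ} (h : a + c ≤ n) :
    Disjoint (lastVars n a) (firstVars n c) := by
  refine Finset.disjoint_left.2 fun q hq hq' => ?_
  rw [mem_lastVars] at hq
  rw [mem_firstVars] at hq'
  omega

/-- The exponent vectors of degree `D` whose degree in the last `a` variables exceeds the degree in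
the first `c` variables. -/
noncomputable def tailRegion (n a c D : ℕ) : Finset (Fin n →₀ ℕ) :=
  region (lastVars n a) (firstVars n c) (fun _ => True) D

theorem mem_tailRegion {a c D : ℕ} {x : Fin n →₀ ℕ} :
    x ∈ tailRegion n a c D ↔ ∑ q, x q = D ∧
      ∑ q ∈ firstVars n c, x q < ∑ q ∈ lastVars n a, x q := by
  simp [tailRegion, mem_region]

theorem tailRegion_mono {a a' c c' D : ℕ} (ha : a ≤ a') (hc : c' ≤ c) :
    tailRegion n a c D ⊆ tailRegion n a' c' D := by
  intro x hx
  rw [mem_tailRegion] at hx ⊢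
  refine ⟨hx.1, (Finset.sum_le_sum_of_subset fun q hq => ?_).trans_lt
    (hx.2.trans_le (Finset.sum_le_sum_of_subset fun q hq => ?_))⟩
  · rw [mem_firstVars] at hq ⊢
    omega
  · rw [mem_lastVars] at hq ⊢
    omega

theorem two_pow_mul_card_tailRegion_le {a c m : ℕ} (h : a + c = m + 1) (hn : m < n) (D : ℕ) :
    2 ^ m * (tailRegion n a c D).card ≤ chooseSum m a * numMonomials n (D + m) := by
  have h1 := two_pow_mul_card_region_le (K := univ) (Q := fun _ : Fin n →₀ ℕ => True)
    (fun _ _ _ _ => trivial) m (lastVars n a) (firstVars n c) D (disjoint_last_first (by omega))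
    (subset_univ _) (subset_univ _) (by
      rw [card_lastVars (by omega), card_firstVars (by omega), h])
  rwa [card_lastVars (by omega)] at h1

theorem le_two_pow_mul_card_tailRegion {a c m : ℕ} (h : a + c = m + 1) (hn : m < n) (D : ℕ) :
    chooseSum m a * numMonomials n D ≤ 2 ^ m * (tailRegion n a c (D + m + 1)).card := by
  have h1 := chooseSum_mul_le_two_pow_mul_card_region m (lastVars n a) (firstVars n c) D
    (disjoint_last_first (by omega)) (by
      rw [card_lastVars (by omega), card_firstVars (by omega), h])
  rwa [card_lastVars (by omega)] at h1

/-- Contrapositive of `mem_sumset_of_sum_le`, with a variable replaced by its number j of later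
variables. -/
theorem exists_tailRegion_of_mem_gaps {M : Set (Fin n →₀ ℕ)} (hM : IsStronglyStable 2 M) {i : ℕ}
    {x : Fin n →₀ ℕ} (hx : x ∈ gaps M i) :
    ∃ j, 0 < rowLen M j ∧ x ∈ tailRegion n (j + 1) (n - (j + rowLen M j)) (2 * i) := by
  classical
  obtain ⟨hdeg, hnot⟩ := mem_degreeSlice.1 hx
  by_contra hcon
  refine hnot (mem_sumset_of_sum_le hM i x ((Finsupp.degree_eq_sum x).trans hdeg) fun p hpp => ?_)
  by_contra hlt
  rw [not_le] at hlt
  have hp : p.val + (n - 1 - p.val) + 1 = n := by omega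
  have hpos := (rowLen_pos_iff hM hp).2 hpp
  refine hcon ⟨n - 1 - p.val, hpos, mem_tailRegion.2 ⟨hdeg, ?_⟩⟩
  have hP : firstVars n (n - (n - 1 - p.val + rowLen M (n - 1 - p.val))) =
      ({q | HasPair M p q} : Finset (Fin n)) := by
    ext q
    simp only [mem_firstVars, mem_filter, mem_univ, true_and, hasPair_iff_of_rowLen_pos hM hp hpos]
    omega
  have hA : lastVars n (n - 1 - p.val + 1) = ({q | p ≤ q} : Finset (Fin n)) := by
    ext q
    simp only [mem_lastVars, mem_filter, mem_univ, true_and, Fin.le_def]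
    omega
  rw [hP, hA]
  exact hlt

theorem sum_le_of_mem_sumset {M : Set (Fin n →₀ ℕ)} {A P : Finset (Fin n)}
    (hM : ∀ m ∈ M, ∑ q ∈ A, m q ≤ ∑ q ∈ P, m q) (i : ℕ) :
    ∀ x ∈ sumset M i, ∑ q ∈ A, x q ≤ ∑ q ∈ P, x q := by
  induction i with
  | zero =>
    rintro x rfl
    simp
  | succ i ih =>
    rintro _ ⟨a, ha, b, hb, rfl⟩
    simp only [Finsupp.add_apply, Finset.sum_add_distrib]
    exact Nat.add_le_add (ih a ha) (hM b hb)

/-- A member of M with a factor among the last a variables has its other factor among the first c.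
Hence its degree in the former is at most its degree in the latter, and this passes to products. -/
theorem tailRegion_subset_gaps {M : Set (Fin n →₀ ℕ)} (hM : ∀ m ∈ M, m.degree = 2) {a c : ℕ}
    (hac : a + c ≤ n) (h : ∀ p q : Fin n, n ≤ p.val + a → c ≤ q.val → ¬ HasPair M p q) (i : ℕ) :
    tailRegion n a c (2 * i) ⊆ gaps M i := by
  intro x hx
  rw [mem_tailRegion] at hx
  refine mem_degreeSlice.2 ⟨hx.1, fun hmem => not_le.2 hx.2 (sum_le_of_mem_sumset ?_ i x hmem)⟩
  intro m hm
  obtain ⟨p, q, rfl⟩ := exists_pair_of_degree_eq_two (hM m hm)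
  have h1 := sum_single_add_eq (lastVars n a) p q 0
  have h2 := sum_single_add_eq (firstVars n c) p q 0
  simp only [add_zero, Finsupp.coe_zero, Pi.zero_apply, sum_const_zero, mem_lastVars,
    mem_firstVars] at h1 h2
  rw [h1, h2]
  by_cases hp : n ≤ p.val + a
  · have hq : q.val < c := by
      by_contra hq
      exact h p q hp (not_lt.1 hq) hm
    rw [if_pos hq, if_neg (show ¬ n ≤ q.val + a by omega)]
    split_ifs <;> omega
  · by_cases hq : n ≤ q.val + a
    · have hpc : p.val < c := by
        by_contra hpc
        exact h q p hq (not_lt.1 hpc) (HasPair.symm hm)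
      rw [if_pos hpc, if_neg hp]
      split_ifs <;> omega
    · rw [if_neg hp, if_neg hq]
      omega

end Gaps

/-! ### The part of a tail region outside the balanced one -/

section Excess

variable {ι : Type*} [Fintype ι] [DecidableEq ι]

/-- The exponent vectors of degree `D` whose degree in `A` exceeds the degree in `P`, while the
degree in `A ∪ B` is at most the degree in `P ∪ {v}`. -/
noncomputable def pinch (A P B : Finset ι) (v : ι) (D : ℕ) : Finset (ι →₀ ℕ) :=
  region A P (fun x => ∑ q ∈ A, x q + ∑ q ∈ B, x q ≤ ∑ q ∈ P, x q + x v) D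

/-- The larger half of the exponent of k moves to v, so the half left at k no longer violates the
upper inequality. The lost parity costs the factor 2. -/
theorem card_pinch_le_insert {A P B : Finset ι} {v k : ι} (hvA : v ∉ A) (hvP : v ∉ P) (hvB : v ∉ B)
    (hkA : k ∉ A) (hkP : k ∉ P) (hkB : k ∉ B) (hkv : k ≠ v) (D : ℕ) :
    (pinch A P B v D).card ≤ 2 * (pinch A P (insert k B) v D).card := by
  refine card_le_two_mul (fun x => transfer x k (x k - x k / 2) v (x k - x k / 2) v 0)
    (fun x => x k % 2) (fun x _ => Nat.mod_lt _ two_pos) ?_ ?_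
  · intro x hx
    obtain ⟨hD, hlt, hle⟩ := mem_region.1 hx
    have hc : x k - x k / 2 ≤ x k := Nat.sub_le _ _
    have h1 := sum_transfer univ hc v (x k - x k / 2) v 0
    have h2 := sum_transfer A hc v (x k - x k / 2) v 0
    have h3 := sum_transfer P hc v (x k - x k / 2) v 0
    have h4 := sum_transfer B hc v (x k - x k / 2) v 0
    simp only [mem_univ, if_true, hvA, hvP, hvB, hkA, hkP, hkB, if_false] at h1 h2 h3 h4
    refine mem_region.2 ⟨by omega, by omega, ?_⟩
    rw [Finset.sum_insert hkB]
    have h5 : transfer x k (x k - x k / 2) v (x k - x k / 2) v 0 k = x k / 2 := by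
      simp only [transfer_apply, if_true, hkv.symm, if_false]
      omega
    have h6 : transfer x k (x k - x k / 2) v (x k - x k / 2) v 0 v = x v + (x k - x k / 2) := by
      simp only [transfer_apply, if_true, hkv, if_false]
      omega
    rw [h5, h6]
    omega
  · intro x hx x' hx' heq hmod
    have hpt := fun q => DFunLike.congr_fun heq q
    simp only [transfer_apply] at hpt
    have h1 := hpt k
    have h2 := hpt v
    simp only [hkv, if_true, if_false, hkv.symm] at h1 h2
    ext q
    by_cases hqk : k = q
    · subst hqk; omega
    by_cases hqv : v = q
    · subst hqv; omega
    simpa [hqk, hqv] using hpt q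

theorem card_pinch_empty_le {A P : Finset ι} {v : ι} (hvA : v ∉ A) (hvP : v ∉ P) (D : ℕ)
    (B : Finset ι) (hB : ∀ k ∈ B, k ∉ A ∧ k ∉ P ∧ k ≠ v) :
    (pinch A P ∅ v D).card ≤ 2 ^ B.card * (pinch A P B v D).card := by
  induction B using Finset.induction_on with
  | empty => simp
  | insert k B hk ih =>
    have h1 := ih fun q hq => hB q (mem_insert_of_mem hq)
    obtain ⟨hkA, hkP, hkv⟩ := hB k (mem_insert_self _ _)
    have hvB : v ∉ B := fun h => (hB v (mem_insert_of_mem h)).2.2 rfl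
    have h2 := card_pinch_le_insert hvA hvP hvB hkA hkP hk hkv D
    rw [card_insert_of_notMem hk, pow_succ, mul_assoc]
    exact h1.trans (Nat.mul_le_mul_left _ h2)

theorem card_region_le_pinch_add (A : Finset ι) {P : Finset ι} {v : ι} (hvP : v ∉ P) (D : ℕ) :
    (region A P (fun _ => True) D).card ≤
      (pinch A P ∅ v D).card + (region A (insert v P) (fun _ => True) D).card := by
  refine (Finset.card_le_card fun x hx => ?_).trans (Finset.card_union_le _ _)
  obtain ⟨hD, hlt, -⟩ := mem_region.1 hx
  rw [mem_union]
  by_cases h : ∑ q ∈ A, x q ≤ ∑ q ∈ P, x q + x v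
  · exact Or.inl (mem_region.2 ⟨hD, hlt, by simpa using h⟩)
  · refine Or.inr (mem_region.2 ⟨hD, ?_, trivial⟩)
    rw [sum_insert hvP]
    omega

variable {n : ℕ}

/-- The variables with (zero-based) index in `[b, c)`. -/
def midVars (n b c : ℕ) : Finset (Fin n) := {q | b ≤ q.val ∧ q.val < c}

theorem mem_midVars {b c : ℕ} {q : Fin n} : q ∈ midVars n b c ↔ b ≤ q.val ∧ q.val < c := by
  simp [midVars]

theorem card_midVars {b c : ℕ} (hbc : b ≤ c) (hc : c ≤ n) : (midVars n b c).card = c - b := by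
  have h : firstVars n b ∪ midVars n b c = firstVars n c := by
    ext q
    rw [mem_union, mem_firstVars, mem_firstVars, mem_midVars]
    omega
  have hd : Disjoint (firstVars n b) (midVars n b c) := by
    refine Finset.disjoint_left.2 fun q hq hq' => ?_
    rw [mem_firstVars] at hq
    rw [mem_midVars] at hq'
    omega
  have := Finset.card_union_of_disjoint hd
  rw [h, card_firstVars hc, card_firstVars (hbc.trans hc)] at this
  omega

theorem disjoint_mid_first {b c d : ℕ} (h : d ≤ b) :
    Disjoint (midVars n b c) (firstVars n d) := by
  refine Finset.disjoint_left.2 fun q hq hq' => ?_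
  rw [mem_midVars] at hq
  rw [mem_firstVars] at hq'
  omega

theorem sum_firstVars_eq {b c : ℕ} (hbc : b ≤ c) (x : Fin n →₀ ℕ) :
    ∑ q ∈ firstVars n c, x q = ∑ q ∈ firstVars n b, x q + ∑ q ∈ midVars n b c, x q := by
  rw [← Finset.sum_union (disjoint_mid_first le_rfl).symm]
  refine Finset.sum_congr ?_ fun _ _ => rfl
  ext q
  rw [mem_union, mem_firstVars, mem_firstVars, mem_midVars]
  omega

theorem sum_lastVars_eq {a r : ℕ} (har : a ≤ r) (x : Fin n →₀ ℕ) :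
    ∑ q ∈ lastVars n r, x q =
      ∑ q ∈ lastVars n a, x q + ∑ q ∈ midVars n (n - r) (n - a), x q := by
  rw [← Finset.sum_union]
  · refine Finset.sum_congr ?_ fun _ _ => rfl
    ext q
    rw [mem_union, mem_lastVars, mem_lastVars, mem_midVars]
    omega
  · refine Finset.disjoint_left.2 fun q hq hq' => ?_
    rw [mem_lastVars] at hq
    rw [mem_midVars] at hq'
    omega

/-- Upper bound for the part of a tail region outside the balanced tail region. -/
theorem two_pow_mul_card_sdiff_le {a r c m₁ m₂ : ℕ} (ha : 0 < a) (har : a ≤ r) (hcr : c + r < n)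
    (h₁ : a + c = m₁ + 1) (h₂ : m₁ + m₂ + 2 = n) (D : ℕ) :
    2 ^ (m₁ + m₂) * (tailRegion n a c D \ tailRegion n r (n - r) D).card ≤
      chooseSum m₁ a * chooseSum m₂ (n - r - c) * numMonomials n (D + (m₁ + m₂)) := by
  set B := midVars n (n - r) (n - a)
  set V := midVars n c (n - r)
  -- Outside the balanced region, an excess of the last a variables over the first c must be made up
  -- by V over B. `Q` involves no variable of K, so the two densities multiply.
  set Q : (Fin n →₀ ℕ) → Prop := fun x => ∑ q ∈ B, x q < ∑ q ∈ V, x q with hQ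
  set K := lastVars n a ∪ firstVars n c
  have hKB : ∀ q ∈ B, q ∉ K := by
    intro q hq hq'
    rw [mem_midVars] at hq
    rw [mem_union, mem_lastVars, mem_firstVars] at hq'
    omega
  have hKV : ∀ q ∈ V, q ∉ K := by
    intro q hq hq'
    rw [mem_midVars] at hq
    rw [mem_union, mem_lastVars, mem_firstVars] at hq'
    omega
  have hind : IndepOf K Q := by
    intro x y hxy hx
    change ∑ q ∈ B, y q < ∑ q ∈ V, y q
    rw [hQ] at hx
    rwa [← Finset.sum_congr rfl fun q hq => hxy q (hKB q hq),
      ← Finset.sum_congr rfl fun q hq => hxy q (hKV q hq)]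
  have hsub : tailRegion n a c D \ tailRegion n r (n - r) D ⊆
      region (lastVars n a) (firstVars n c) Q D := by
    intro x hx
    rw [mem_sdiff, mem_tailRegion, mem_tailRegion] at hx
    obtain ⟨⟨hD, hlt⟩, hnot⟩ := hx
    refine mem_region.2 ⟨hD, hlt, ?_⟩
    rw [sum_firstVars_eq (show c ≤ n - r by omega), sum_lastVars_eq har] at hnot
    change ¬ (∑ q, x q = D ∧ ∑ q ∈ firstVars n c, x q + ∑ q ∈ V, x q <
      ∑ q ∈ lastVars n a, x q + ∑ q ∈ B, x q) at hnot
    rw [hQ]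
    by_contra hcon
    exact hnot ⟨hD, by omega⟩
  have h3 := two_pow_mul_card_region_le hind m₁ (lastVars n a) (firstVars n c) D
    (disjoint_last_first (by omega)) subset_union_left subset_union_right
    (by rw [card_lastVars (by omega), card_firstVars (by omega), h₁])
  rw [card_lastVars (by omega)] at h3
  have h4 := two_pow_mul_card_region_le (K := univ) (Q := fun _ : Fin n →₀ ℕ => True)
    (fun _ _ _ _ => trivial) m₂ V B (D + m₁)
    (by
      refine Finset.disjoint_left.2 fun q hq hq' => ?_
      rw [mem_midVars] at hq hq'
      omega)
    (subset_univ _) (subset_univ _)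
    (by rw [card_midVars (by omega) (by omega), card_midVars (by omega) (by omega)]; omega)
  rw [card_midVars (by omega) (by omega)] at h4
  have h5 : degreeSlice Q (D + m₁) = region V B (fun _ => True) (D + m₁) := by
    ext x
    rw [mem_degreeSlice, mem_region]
    simp [hQ]
  rw [h5] at h3
  calc 2 ^ (m₁ + m₂) * (tailRegion n a c D \ tailRegion n r (n - r) D).card
      ≤ 2 ^ m₂ * (2 ^ m₁ * (region (lastVars n a) (firstVars n c) Q D).card) := by
        rw [pow_add, mul_comm (2 ^ m₁), mul_assoc]
        exact Nat.mul_le_mul_left _ (Nat.mul_le_mul_left _ (Finset.card_le_card hsub))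
    _ ≤ 2 ^ m₂ * (chooseSum m₁ a * (region V B (fun _ => True) (D + m₁)).card) :=
        Nat.mul_le_mul_left _ h3
    _ = chooseSum m₁ a * (2 ^ m₂ * (region V B (fun _ => True) (D + m₁)).card) := by ring
    _ ≤ chooseSum m₁ a * (chooseSum m₂ (n - r - c) * numMonomials n (D + m₁ + m₂)) :=
        Nat.mul_le_mul_left _ h4
    _ = _ := by rw [mul_assoc, add_assoc]

/-- Lower bound for the part of a tail region outside the balanced tail region. -/
theorem le_two_pow_mul_card_sdiff {t r m : ℕ} (htr : t ≤ r) (hr : r < n)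
    (hm : t + (n - r - 1) = m + 1) {D : ℕ} (hD : m + 1 ≤ D) :
    2 * chooseSum m t * numMonomials n (D - (m + 1)) ≤
      2 ^ (n - 1) * (tailRegion n t (n - r - 1) D \ tailRegion n r (n - r) D).card +
        chooseSum (m + 1) t * numMonomials n (D + (m + 1)) := by
  have hlt : n - r - 1 < n := by omega
  set v : Fin n := ⟨n - r - 1, hlt⟩ with hv
  set A := lastVars n t with hA
  set P := firstVars n (n - r - 1) with hP
  set B := midVars n (n - r) (n - t) with hB
  have hvA : v ∉ A := by
    rw [mem_lastVars, hv]
    simp only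
    omega
  have hvP : v ∉ P := by
    rw [mem_firstVars, hv]
    simp only
    omega
  have hins : insert v P = firstVars n (n - r) := by
    ext q
    rw [mem_insert, mem_firstVars, mem_firstVars, hv, Fin.ext_iff]
    simp only
    omega
  have h1 := le_two_pow_mul_card_tailRegion (n := n) hm (by omega) (D - (m + 1))
  rw [add_assoc, Nat.sub_add_cancel hD] at h1
  have h2 := two_pow_mul_card_tailRegion_le (n := n) (a := t) (c := n - r) (m := m + 1) (by omega)
    (by omega) D
  have h3 := card_region_le_pinch_add A hvP D
  rw [hins] at h3
  have h4 := card_pinch_empty_le hvA hvP D B (fun k hk => by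
    rw [mem_midVars] at hk
    refine ⟨?_, ?_, ?_⟩
    · rw [mem_lastVars]
      omega
    · rw [mem_firstVars]
      omega
    · rw [Ne, Fin.ext_iff, hv]
      simp only
      omega)
  rw [card_midVars (by omega) (by omega)] at h4
  have h5 : pinch A P B v D ⊆ tailRegion n t (n - r - 1) D \ tailRegion n r (n - r) D := by
    intro x hx
    obtain ⟨hD, hlt, hle⟩ := mem_region.1 hx
    rw [mem_sdiff, mem_tailRegion, mem_tailRegion]
    refine ⟨⟨hD, hlt⟩, fun h => not_lt.2 hle ?_⟩
    have h := h.2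
    rwa [← hins, sum_insert hvP, sum_lastVars_eq htr, add_comm (x v)] at h
  have h6 := Finset.card_le_card h5
  set X := (tailRegion n t (n - r - 1) D \ tailRegion n r (n - r) D).card
  -- B has r - t variables, each costing a factor 2, and m + 1 + (r - t) = n - 1.
  have h7 : 2 ^ (m + 1) * (pinch A P ∅ v D).card ≤ 2 ^ (n - 1) * X := by
    refine (Nat.mul_le_mul_left _ (h4.trans (Nat.mul_le_mul_left _ h6))).trans (le_of_eq ?_)
    rw [← mul_assoc, ← pow_add]
    congr 2
    omega
  have h8 : 2 ^ (m + 1) * (tailRegion n t (n - r - 1) D).card ≤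
      2 ^ (m + 1) * (pinch A P ∅ v D).card + 2 ^ (m + 1) * (tailRegion n t (n - r) D).card := by
    rw [← mul_add]
    exact Nat.mul_le_mul_left _ h3
  rw [pow_succ, mul_comm (2 ^ m), mul_assoc] at h8
  rw [mul_assoc]
  rw [pow_succ, mul_comm (2 ^ m)] at h2 h7
  simp only [mul_assoc] at h2 h7 h8 ⊢
  omega

end Excess

/-! ### Growth of binomial sums, and strict partitions of numbers up to 25 -/

section Numerics

theorem chooseSum_mono {m m' a a' : ℕ} (hm : m ≤ m') (ha : a ≤ a') :
    chooseSum m a ≤ chooseSum m' a' :=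
  (Finset.sum_le_sum fun j _ => Nat.choose_le_choose j hm).trans
    (Finset.sum_le_sum_of_subset (Finset.range_mono ha))

theorem chooseSum_one (m : ℕ) : chooseSum m 1 = 1 := by simp [chooseSum]

/-- By Pascal's rule the increment in m of the inequality is the corresponding one for a, so one
numerical check starts the induction. -/
theorem mul_chooseSum_le_of_base {m₀ c c' a : ℕ} (hc : c' ≤ c)
    (h : ∀ m, m₀ ≤ m → c * chooseSum m a ≤ chooseSum m (a + 1))
    (hbase : c' * chooseSum m₀ (a + 1) ≤ chooseSum m₀ (a + 2)) :
    ∀ m, m₀ ≤ m → c' * chooseSum m (a + 1) ≤ chooseSum m (a + 2) := by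
  intro m hm
  induction m, hm using Nat.le_induction with
  | base => exact hbase
  | succ m hm ih =>
    rw [chooseSum_succ_succ, chooseSum_succ_succ m (a + 1), mul_add]
    exact add_le_add ih ((Nat.mul_le_mul_right _ hc).trans (h m hm))

/-- The factors are the integer parts of the ratios at m = 74, the least value of n + t - r - 2 for
n ≥ 80, t ≥ 2, r ≤ 6. -/
theorem chooseSum_growth {m : ℕ} (hm : 74 ≤ m) :
    75 * chooseSum m 1 ≤ chooseSum m 2 ∧ 37 * chooseSum m 2 ≤ chooseSum m 3 ∧
      24 * chooseSum m 3 ≤ chooseSum m 4 ∧ 18 * chooseSum m 4 ≤ chooseSum m 5 := by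
  have h0 : ∀ m, 74 ≤ m → 75 * chooseSum m 0 ≤ chooseSum m 1 := fun m _ => by simp [chooseSum]
  have h1 := mul_chooseSum_le_of_base (c' := 75) le_rfl h0 (by decide)
  have h2 := mul_chooseSum_le_of_base (c' := 37) (by norm_num) h1 (by decide)
  have h3 := mul_chooseSum_le_of_base (c' := 24) (by norm_num) h2 (by decide +kernel)
  have h4 := mul_chooseSum_le_of_base (c' := 18) (by norm_num) h3 (by decide +kernel)
  exact ⟨h1 m hm, h2 m hm, h3 m hm, h4 m hm⟩

theorem chooseSum_growth' {m : ℕ} (hm : 79 ≤ m) :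
    80 * chooseSum m 1 ≤ chooseSum m 2 ∧ 39 * chooseSum m 2 ≤ chooseSum m 3 ∧
      26 * chooseSum m 3 ≤ chooseSum m 4 ∧ 19 * chooseSum m 4 ≤ chooseSum m 5 ∧
      15 * chooseSum m 5 ≤ chooseSum m 6 := by
  have h0 : ∀ m, 79 ≤ m → 80 * chooseSum m 0 ≤ chooseSum m 1 := fun m _ => by simp [chooseSum]
  have h1 := mul_chooseSum_le_of_base (c' := 80) le_rfl h0 (by decide +kernel)
  have h2 := mul_chooseSum_le_of_base (c' := 39) (by norm_num) h1 (by decide +kernel)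
  have h3 := mul_chooseSum_le_of_base (c' := 26) (by norm_num) h2 (by decide +kernel)
  have h4 := mul_chooseSum_le_of_base (c' := 19) (by norm_num) h3 (by decide +kernel)
  have h5 := mul_chooseSum_le_of_base (c' := 15) (by norm_num) h4 (by decide +kernel)
  exact ⟨h1 m hm, h2 m hm, h3 m hm, h4 m hm, h5 m hm⟩

/-- The rows of a strict partition of `s`. -/
structure IsStrictRows (l : ℕ → ℕ) (s : ℕ) : Prop where
  succ_lt : ∀ j, 0 < l (j + 1) → l (j + 1) < l j
  eq_zero : ∀ j, 6 ≤ j → l j = 0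
  sum_eq : l 0 + l 1 + l 2 + l 3 + l 4 + l 5 = s

theorem isStrictRows_of_sum {l : ℕ → ℕ} {n s : ℕ} (hlt : ∀ j, 0 < l (j + 1) → l (j + 1) < l j)
    (hn : 7 ≤ n) (hs : s ≤ 25) (hsum : ∑ j ∈ range n, l j = s) : IsStrictRows l s := by
  have h1 : ∑ j ∈ range 7, l j ≤ s :=
    (Finset.sum_le_sum_of_subset (Finset.range_mono hn)).trans hsum.le
  simp only [Finset.sum_range_succ, Finset.sum_range_zero] at h1
  -- Seven nonzero rows would sum to at least 28.
  have h6 : l 6 = 0 := by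
    have := hlt 0
    have := hlt 1
    have := hlt 2
    have := hlt 3
    have := hlt 4
    have := hlt 5
    norm_num at *
    omega
  have h0 : ∀ j, 6 ≤ j → l j = 0 := by
    intro j hj
    induction j, hj using Nat.le_induction with
    | base => exact h6
    | succ j hj ih =>
      have := hlt j
      omega
  refine ⟨hlt, h0, ?_⟩
  rw [← hsum, ← Finset.sum_subset (Finset.range_mono (show 6 ≤ n by omega))
    (fun j _ hj => h0 j (by simpa using hj))]
  simp [Finset.sum_range_succ]

theorem IsStrictRows.chain {l : ℕ → ℕ} {s : ℕ} (h : IsStrictRows l s) :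
    (0 < l 1 → l 1 < l 0) ∧ (0 < l 2 → l 2 < l 1) ∧ (0 < l 3 → l 3 < l 2) ∧
      (0 < l 4 → l 4 < l 3) ∧ (0 < l 5 → l 5 < l 4) ∧
      l 0 + l 1 + l 2 + l 3 + l 4 + l 5 = s :=
  ⟨h.succ_lt 0, h.succ_lt 1, h.succ_lt 2, h.succ_lt 3, h.succ_lt 4, h.sum_eq⟩

theorem exists_triangular {s : ℕ} (hs : s ≤ 25) :
    ∃ r t, r ≤ 6 ∧ t ≤ r ∧ (r + 1).choose 2 + t = s := by
  have h : ∀ s ≤ 25, ∃ r ≤ 6, ∃ t ≤ r, (r + 1).choose 2 + t = s := by decide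
  obtain ⟨r, hr, t, ht, h⟩ := h s hs
  exact ⟨r, t, hr, ht, h⟩

/-- The contribution of the `j`-th row to the leading coefficient of the number of gaps. -/
def rowCoeff (l : ℕ → ℕ) (n j : ℕ) : ℕ :=
  if 0 < l j then 2 ^ (l j - 1) * chooseSum (n - l j) (j + 1) else 0

theorem rowCoeff_le {l : ℕ → ℕ} {n j b : ℕ} (h : l j ≤ b) :
    rowCoeff l n j ≤ 2 ^ (b - 1) * chooseSum (n - 1) (j + 1) := by
  rw [rowCoeff]
  split_ifs with h0
  · exact Nat.mul_le_mul (Nat.pow_le_pow_right two_pos (by omega))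
      (chooseSum_mono (by omega) le_rfl)
  · exact Nat.zero_le _

theorem rowCoeff_eq_zero {l : ℕ → ℕ} {n j : ℕ} (h : l j = 0) : rowCoeff l n j = 0 := by
  simp [rowCoeff, h]

/-- Row j contributes at most a power of two times `chooseSum (n - 1) (j + 1)` with j ≤ r - 2. The
growth factors at n - 1 ≥ 79 outweigh these powers. -/
theorem sum_rowCoeff_lt {l : ℕ → ℕ} {n s r t : ℕ} (hn : 80 ≤ n) (hs : s ≤ 25) (hr0 : 0 < r)
    (hr : r ≤ 6) (ht : t ≤ r) (hrt : (r + 1).choose 2 + t = s) (hl : IsStrictRows l s)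
    (h0 : l (r - 1) = 0) : ∑ j ∈ range 6, rowCoeff l n j < chooseSum (n - 1) r := by
  obtain ⟨h1, h2, h3, h4, h5, hsum⟩ := hl.chain
  obtain ⟨g1, g2, g3, g4, g5⟩ := chooseSum_growth' (show 79 ≤ n - 1 by omega)
  have hone := chooseSum_one (n - 1)
  simp only [Finset.sum_range_succ, Finset.sum_range_zero]
  interval_cases r
  · have : l 0 = 0 := h0
    norm_num [Nat.choose] at hrt
    omega
  · have : l 1 = 0 := h0
    norm_num [Nat.choose] at hrt
    have e0 := rowCoeff_le (n := n) (show l 0 ≤ 5 by omega)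
    have e1 := rowCoeff_eq_zero (n := n) (show l 1 = 0 by omega)
    have e2 := rowCoeff_eq_zero (n := n) (show l 2 = 0 by omega)
    have e3 := rowCoeff_eq_zero (n := n) (show l 3 = 0 by omega)
    have e4 := rowCoeff_eq_zero (n := n) (show l 4 = 0 by omega)
    have e5 := rowCoeff_eq_zero (n := n) (show l 5 = 0 by omega)
    norm_num at e0
    omega
  · have : l 2 = 0 := h0
    norm_num [Nat.choose] at hrt
    have e0 := rowCoeff_le (n := n) (show l 0 ≤ 9 by omega)
    have e1 := rowCoeff_le (n := n) (show l 1 ≤ 4 by omega)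
    have e2 := rowCoeff_eq_zero (n := n) (show l 2 = 0 by omega)
    have e3 := rowCoeff_eq_zero (n := n) (show l 3 = 0 by omega)
    have e4 := rowCoeff_eq_zero (n := n) (show l 4 = 0 by omega)
    have e5 := rowCoeff_eq_zero (n := n) (show l 5 = 0 by omega)
    norm_num at e0 e1
    omega
  · have : l 3 = 0 := h0
    norm_num [Nat.choose] at hrt
    have e0 := rowCoeff_le (n := n) (show l 0 ≤ 14 by omega)
    have e1 := rowCoeff_le (n := n) (show l 1 ≤ 6 by omega)
    have e2 := rowCoeff_le (n := n) (show l 2 ≤ 3 by omega)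
    have e3 := rowCoeff_eq_zero (n := n) (show l 3 = 0 by omega)
    have e4 := rowCoeff_eq_zero (n := n) (show l 4 = 0 by omega)
    have e5 := rowCoeff_eq_zero (n := n) (show l 5 = 0 by omega)
    norm_num at e0 e1 e2
    omega
  · have : l 4 = 0 := h0
    norm_num [Nat.choose] at hrt
    have e0 := rowCoeff_le (n := n) (show l 0 ≤ 20 by omega)
    have e1 := rowCoeff_le (n := n) (show l 1 ≤ 9 by omega)
    have e2 := rowCoeff_le (n := n) (show l 2 ≤ 5 by omega)
    have e3 := rowCoeff_le (n := n) (show l 3 ≤ 3 by omega)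
    have e4 := rowCoeff_eq_zero (n := n) (show l 4 = 0 by omega)
    have e5 := rowCoeff_eq_zero (n := n) (show l 5 = 0 by omega)
    norm_num at e0 e1 e2 e3
    omega
  · have : l 5 = 0 := h0
    norm_num [Nat.choose] at hrt
    have e5 := rowCoeff_eq_zero (n := n) (show l 5 = 0 by omega)
    -- A row of length 25 is the only row. At n = 80 its coefficient 2^24 fits below `chooseSum 79
    -- 6` = 24122256, but not together with the bounds used for the other rows.
    rcases Nat.lt_or_ge (l 0) 25 with h | h
    · have e0 := rowCoeff_le (n := n) (show l 0 ≤ 24 by omega)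
      have e1 := rowCoeff_le (n := n) (show l 1 ≤ 12 by omega)
      have e2 := rowCoeff_le (n := n) (show l 2 ≤ 7 by omega)
      have e3 := rowCoeff_le (n := n) (show l 3 ≤ 4 by omega)
      have e4 := rowCoeff_le (n := n) (show l 4 ≤ 3 by omega)
      norm_num at e0 e1 e2 e3 e4
      omega
    · have e0 := rowCoeff_le (n := n) (show l 0 ≤ 25 by omega)
      have e1 := rowCoeff_eq_zero (n := n) (show l 1 = 0 by omega)
      have e2 := rowCoeff_eq_zero (n := n) (show l 2 = 0 by omega)
      have e3 := rowCoeff_eq_zero (n := n) (show l 3 = 0 by omega)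
      have e4 := rowCoeff_eq_zero (n := n) (show l 4 = 0 by omega)
      norm_num at e0
      omega

/-- A further row would force a sum above s, so there are exactly r rows. The numbers j + l_j - r
are then nonnegative, weakly decreasing and sum to t. If the first is at most 1, the first t equal 1
and the rest 0; if it is at least 2, fewer than t are positive. -/
theorem IsStrictRows.le_add_of_pos {l : ℕ → ℕ} {s r t : ℕ} (hr : r ≤ 6) (ht : t ≤ r)
    (hrt : (r + 1).choose 2 + t = s) (hl : IsStrictRows l s) (hr0 : 0 < r) (h0 : 0 < l (r - 1))
    {j : ℕ} (hj : 0 < l j) : j < r ∧ r ≤ j + l j ∧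
      (l 0 ≤ r + 1 → j + l j = r ∨ (j < t ∧ j + l j = r + 1)) ∧
      (r + 2 ≤ l 0 → r < j + l j → j + 1 < t) := by
  obtain ⟨h1, h2, h3, h4, h5, hsum⟩ := hl.chain
  have hj6 : j < 6 := by
    by_contra h
    have := hl.eq_zero j (not_lt.1 h)
    omega
  interval_cases r <;> norm_num [Nat.choose] at hrt h0 <;> interval_cases j <;> omega

end Numerics

/-! ### Comparison of an arbitrary strongly stable set with Lex(u) -/

section Comparison

/-- The contribution of the `j`-th row to the leading coefficient of the number of gaps outside the
balanced tail region. -/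
def excessCoeff (l : ℕ → ℕ) (n r j : ℕ) : ℕ :=
  if 0 < l j ∧ r < j + l j then
    2 * (chooseSum (n - l j) (j + 1) * chooseSum (l j - 2) (j + l j - r)) else 0

theorem excessCoeff_eq_zero {l : ℕ → ℕ} {n r j : ℕ} (h : 0 < l j → j + l j ≤ r) :
    excessCoeff l n r j = 0 := by
  rw [excessCoeff, if_neg fun h' => not_lt.2 (h h'.1) h'.2]

theorem excessCoeff_le {l : ℕ → ℕ} {n r j m b e : ℕ} (hm : r < j + l j → n - l j ≤ m)
    (hb : l j - 2 ≤ b) (he : j + l j - r ≤ e) :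
    excessCoeff l n r j ≤ 2 * chooseSum b e * chooseSum m (j + 1) := by
  rw [excessCoeff]
  split_ifs with h
  · rw [mul_assoc, mul_comm (chooseSum b e)]
    exact Nat.mul_le_mul_left _ (Nat.mul_le_mul (chooseSum_mono (hm h.2) le_rfl) (chooseSum_mono hb he))
  · exact Nat.zero_le _

/-- By Pascal's rule the claim says that the sum is below m.choose (t - 1). Only rows with j ≤ t - 2
contribute, each a constant times `chooseSum m (j + 1)`. -/
theorem sum_excessCoeff_lt {l : ℕ → ℕ} {n s r t m : ℕ} (hn : 80 ≤ n) (hs : s ≤ 25) (hr0 : 0 < r)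
    (hr : r ≤ 6) (ht : t ≤ r) (hrt : (r + 1).choose 2 + t = s) (hl : IsStrictRows l s)
    (h0 : 0 < l (r - 1)) (hl0 : r + 2 ≤ l 0) (hm : m + r + 2 = n + t) :
    ∑ j ∈ range 6, excessCoeff l n r j + chooseSum (m + 1) t < 2 * chooseSum m t := by
  have hpos := fun {j : ℕ} (hj : 0 < l j) => hl.le_add_of_pos hr ht hrt hr0 h0 hj
  obtain ⟨h1, h2, h3, h4, h5, hsum⟩ := hl.chain
  have hrt' : (r + 1) * r / 2 + t = s := by rw [← hrt, Nat.choose_two_right]; rfl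
  have ht2 : 2 ≤ t := by
    have := (hpos (j := 0) (by omega)).2.2.2 hl0 (by omega)
    omega
  -- For r = 6 the bound s ≤ 25 leaves t ≤ 4.
  have ht5 : t ≤ 5 := by
    interval_cases r <;> omega
  have hz : ∀ j, t ≤ j + 1 → excessCoeff l n r j = 0 := by
    intro j hj
    refine excessCoeff_eq_zero fun h => ?_
    have := (hpos h).2.2.2 hl0
    omega
  obtain ⟨g1, g2, g3, g4⟩ := chooseSum_growth (show 74 ≤ m by omega)
  have hone := chooseSum_one m
  have z4 := hz 4 (by omega)
  have z5 := hz 5 (by omega)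
  simp only [Finset.sum_range_succ, Finset.sum_range_zero]
  -- The excesses sum to t and the first is at least 2. With r ≤ 6, and r = 5 when t = 5, this
  -- bounds l_j - 2 and j + l_j - r by the arguments of `chooseSum` below.
  interval_cases t
  · have z1 := hz 1 (by omega)
    have z2 := hz 2 (by omega)
    have z3 := hz 3 (by omega)
    have e0 : excessCoeff l n r 0 ≤ 2 * chooseSum 6 2 * chooseSum m 1 :=
      excessCoeff_le (by omega) (by interval_cases r <;> norm_num at h0 <;> omega) (by interval_cases r <;> norm_num at h0 <;> omega)
    rw [show chooseSum 6 2 = 7 by decide] at e0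
    rw [chooseSum_succ_succ]
    simp only [Nat.reduceAdd]
    omega
  · have z2 := hz 2 (by omega)
    have z3 := hz 3 (by omega)
    have e0 : excessCoeff l n r 0 ≤ 2 * chooseSum 7 3 * chooseSum m 1 :=
      excessCoeff_le (by omega) (by interval_cases r <;> norm_num at h0 <;> omega) (by interval_cases r <;> norm_num at h0 <;> omega)
    have e1 : excessCoeff l n r 1 ≤ 2 * chooseSum 4 1 * chooseSum m 2 :=
      excessCoeff_le (by omega) (by interval_cases r <;> norm_num at h0 <;> omega) (by interval_cases r <;> norm_num at h0 <;> omega)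
    rw [show chooseSum 7 3 = 29 by decide] at e0
    rw [show chooseSum 4 1 = 1 by decide] at e1
    rw [chooseSum_succ_succ]
    simp only [Nat.reduceAdd]
    omega
  · have z3 := hz 3 (by omega)
    have e0 : excessCoeff l n r 0 ≤ 2 * chooseSum 8 4 * chooseSum m 1 :=
      excessCoeff_le (by omega) (by interval_cases r <;> norm_num at h0 <;> omega) (by interval_cases r <;> norm_num at h0 <;> omega)
    have e1 : excessCoeff l n r 1 ≤ 2 * chooseSum 5 2 * chooseSum m 2 :=
      excessCoeff_le (by omega) (by interval_cases r <;> norm_num at h0 <;> omega) (by interval_cases r <;> norm_num at h0 <;> omega)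
    have e2 : excessCoeff l n r 2 ≤ 2 * chooseSum 3 1 * chooseSum m 3 :=
      excessCoeff_le (by omega) (by interval_cases r <;> norm_num at h0 <;> omega) (by interval_cases r <;> norm_num at h0 <;> omega)
    rw [show chooseSum 8 4 = 93 by decide] at e0
    rw [show chooseSum 5 2 = 6 by decide] at e1
    rw [show chooseSum 3 1 = 1 by decide] at e2
    rw [chooseSum_succ_succ]
    simp only [Nat.reduceAdd]
    omega
  · have e0 : excessCoeff l n r 0 ≤ 2 * chooseSum 8 5 * chooseSum m 1 :=
      excessCoeff_le (by omega) (by interval_cases r <;> norm_num at h0 <;> omega) (by interval_cases r <;> norm_num at h0 <;> omega)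
    have e1 : excessCoeff l n r 1 ≤ 2 * chooseSum 4 2 * chooseSum m 2 :=
      excessCoeff_le (by omega) (by interval_cases r <;> norm_num at h0 <;> omega) (by interval_cases r <;> norm_num at h0 <;> omega)
    have e2 : excessCoeff l n r 2 ≤ 2 * chooseSum 2 1 * chooseSum m 3 :=
      excessCoeff_le (by omega) (by interval_cases r <;> norm_num at h0 <;> omega) (by interval_cases r <;> norm_num at h0 <;> omega)
    have e3 : excessCoeff l n r 3 ≤ 2 * chooseSum 1 1 * chooseSum m 4 :=
      excessCoeff_le (by omega) (by interval_cases r <;> norm_num at h0 <;> omega) (by interval_cases r <;> norm_num at h0 <;> omega)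
    rw [show chooseSum 8 5 = 163 by decide] at e0
    rw [show chooseSum 4 2 = 5 by decide] at e1
    rw [show chooseSum 2 1 = 1 by decide] at e2
    rw [show chooseSum 1 1 = 1 by decide] at e3
    rw [chooseSum_succ_succ]
    simp only [Nat.reduceAdd]
    omega

open Filter

variable {n : ℕ}

theorem isStrictRows_rowLen {M : Set (Fin n →₀ ℕ)} (hM : IsStronglyStable 2 M) {u s : ℕ}
    (hn : 80 ≤ n) (hs : s ≤ 25) (hu : u + s = (n + 1).choose 2) (hcard : M.ncard = u) :
    IsStrictRows (rowLen M) s := by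
  refine isStrictRows_of_sum (fun j => rowLen_succ_lt hM) (by omega : 7 ≤ n) hs ?_
  have := ncard_add_sum_rowLen hM.1
  omega

/-- The bound for the number of gaps when the rows are fewer than for `Lex(u)`. -/
theorem two_pow_mul_card_gaps_le {M : Set (Fin n →₀ ℕ)} (hM : IsStronglyStable 2 M) {s : ℕ}
    (hn : 80 ≤ n) (hs : s ≤ 25) (hl : IsStrictRows (rowLen M) s) (i : ℕ) :
    2 ^ (n - 1) * (gaps M i).card ≤
      (∑ j ∈ range 6, rowCoeff (rowLen M) n j) * numMonomials n (2 * i + n) := by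
  set l := rowLen M with hldef
  obtain ⟨h1, h2, h3, h4, h5, hsum⟩ := hl.chain
  set X : ℕ → Finset (Fin n →₀ ℕ) := fun j =>
    if 0 < l j then tailRegion n (j + 1) (n - (j + l j)) (2 * i) else ∅ with hX
  have hsub : gaps M i ⊆ (range 6).biUnion X := by
    intro x hx
    obtain ⟨j, hj, hxj⟩ := exists_tailRegion_of_mem_gaps hM hx
    refine mem_biUnion.2 ⟨j, ?_, ?_⟩
    · rw [mem_range]
      by_contra h
      exact hj.ne' (hl.eq_zero j (not_lt.1 h))
    · rw [hX]
      simp only [hldef, if_pos hj]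
      exact hxj
  have hcard := (Finset.card_le_card hsub).trans card_biUnion_le
  refine (Nat.mul_le_mul_left _ hcard).trans ?_
  rw [Finset.mul_sum, Finset.sum_mul]
  refine Finset.sum_le_sum fun j hj => ?_
  rw [hX, rowCoeff]
  simp only
  split_ifs with h
  · have hj6 := mem_range.1 hj
    have hlj : j + l j ≤ n := by
      have : l j ≤ s := by interval_cases j <;> omega
      omega
    have h6 := two_pow_mul_card_tailRegion_le (n := n) (a := j + 1) (c := n - (j + l j))
      (m := n - l j) (by omega) (by omega) (2 * i)
    have h7 : numMonomials n (2 * i + (n - l j)) ≤ numMonomials n (2 * i + n) := by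
      obtain ⟨n, rfl⟩ : ∃ k, n = k + 1 := ⟨n - 1, by omega⟩
      exact monotone_numMonomials _ (by omega)
    -- The region of row j compares n - l_j + 1 variables, so its natural denominator is 2^(n -
    -- l_j); all rows are brought to 2^(n - 1).
    have h8 : 2 ^ (n - 1) = 2 ^ (l j - 1) * 2 ^ (n - l j) := by
      rw [← pow_add]
      congr 1
      omega
    rw [h8, mul_assoc, mul_assoc]
    exact Nat.mul_le_mul_left _ (h6.trans (Nat.mul_le_mul_left _ h7))
  · simp

theorem balanced_subset_gaps_lexExps {u s r : ℕ} (hu : u + s = (n + 1).choose 2)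
    (hs : (r + 1).choose 2 ≤ s) (hr : r ≤ n) (i : ℕ) :
    tailRegion n r (n - r) (2 * i) ⊆ gaps (lexExps n u) i :=
  tailRegion_subset_gaps (isStronglyStable_lexExps n u).1 (by omega)
    (fun _ _ hp hq => not_hasPair_lexExps_of_ge hu hs hr hp (by omega)) i

theorem unbalanced_subset_gaps_lexExps {u s r t : ℕ} (hu : u + s = (n + 1).choose 2)
    (hs : (r + 1).choose 2 + t ≤ s) (hr : r < n) (htr : t ≤ r) (i : ℕ) :
    tailRegion n t (n - r - 1) (2 * i) ⊆ gaps (lexExps n u) i :=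
  tailRegion_subset_gaps (isStronglyStable_lexExps n u).1 (by omega)
    (fun _ _ hp hq h => not_hasPair_lexExps_of_ge_of_ge hu hs hr htr (by omega) hp h.symm) i

theorem eventually_card_gaps_le_of_few_rows {M : Set (Fin n →₀ ℕ)} (hM : IsStronglyStable 2 M)
    {u s r t : ℕ} (hn : 80 ≤ n) (hs : s ≤ 25) (hu : u + s = (n + 1).choose 2) (hr0 : 0 < r)
    (hr : r ≤ 6) (ht : t ≤ r) (hrt : (r + 1).choose 2 + t = s) (hl : IsStrictRows (rowLen M) s)
    (h0 : rowLen M (r - 1) = 0) :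
    ∀ᶠ i in atTop, (gaps M i).card ≤ (gaps (lexExps n u) i).card := by
  have hlt := sum_rowCoeff_lt hn hs hr0 hr ht hrt hl h0
  obtain ⟨n, rfl⟩ : ∃ k, n = k + 1 := ⟨n - 1, by omega⟩
  filter_upwards [eventually_mul_numMonomials_two_mul_le hlt n (n + 1) (n + 1)] with i ⟨hi, hle⟩
  have h1 := two_pow_mul_card_gaps_le hM hn hs hl i
  have h2 := le_two_pow_mul_card_tailRegion (n := n + 1) (a := r) (c := n + 1 - r) (m := n)
    (by omega) (by omega) (2 * i - (n + 1))
  rw [add_assoc, Nat.sub_add_cancel hi] at h2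
  -- E₀ alone already outnumbers the gaps of M.
  have h3 := Finset.card_le_card (balanced_subset_gaps_lexExps hu (by omega) (by omega : r ≤ n + 1) i)
  have h4 : 2 ^ n * (gaps M i).card ≤ 2 ^ n * (gaps (lexExps (n + 1) u) i).card :=
    (h1.trans hle).trans (h2.trans (Nat.mul_le_mul_left _ h3))
  exact Nat.le_of_mul_le_mul_left h4 (by positivity)

theorem gaps_subset_of_short_first_row {M : Set (Fin n →₀ ℕ)} (hM : IsStronglyStable 2 M)
    {u s r t : ℕ} (hn : 80 ≤ n) (hu : u + s = (n + 1).choose 2) (hr0 : 0 < r)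
    (hr : r ≤ 6) (ht : t ≤ r) (hrt : (r + 1).choose 2 + t = s) (hl : IsStrictRows (rowLen M) s)
    (h0 : 0 < rowLen M (r - 1)) (hl0 : rowLen M 0 ≤ r + 1) (i : ℕ) :
    gaps M i ⊆ gaps (lexExps n u) i := by
  intro x hx
  obtain ⟨j, hj, hxj⟩ := exists_tailRegion_of_mem_gaps hM hx
  obtain ⟨hjr, -, h, -⟩ := hl.le_add_of_pos hr ht hrt hr0 h0 hj
  rcases h hl0 with h | ⟨hjt, h⟩
  · exact balanced_subset_gaps_lexExps (r := r) hu (by omega) (by omega) i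
      (tailRegion_mono (by omega) (by omega) hxj)
  · exact unbalanced_subset_gaps_lexExps hu hrt.le (by omega) ht i
      (tailRegion_mono (by omega) (by omega) hxj)

/-- Both sets of gaps are measured against E₀: those of M lie in E₀ and the excess parts of its
rows, while those of Lex contain E₀ and E₁ \ E₀. -/
theorem eventually_card_gaps_le_of_long_first_row {M : Set (Fin n →₀ ℕ)}
    (hM : IsStronglyStable 2 M) {u s r t : ℕ} (hn : 80 ≤ n) (hs : s ≤ 25)
    (hu : u + s = (n + 1).choose 2) (hr0 : 0 < r) (hr : r ≤ 6) (ht : t ≤ r)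
    (hrt : (r + 1).choose 2 + t = s) (hl : IsStrictRows (rowLen M) s)
    (h0 : 0 < rowLen M (r - 1)) (hl0 : r + 2 ≤ rowLen M 0) :
    ∀ᶠ i in atTop, (gaps M i).card ≤ (gaps (lexExps n u) i).card := by
  have hpos := fun {j : ℕ} (hj : 0 < rowLen M j) => hl.le_add_of_pos hr ht hrt hr0 h0 hj
  have ht2 : 2 ≤ t := by
    have := (hpos (j := 0) (by omega)).2.2.2 hl0 (by omega)
    omega
  set m := n + t - r - 2 with hm
  have hlt := sum_excessCoeff_lt (m := m) hn hs hr0 hr ht hrt hl h0 hl0 (by omega)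
  set l := rowLen M with hldef
  obtain ⟨n', hn'⟩ : ∃ k, n = k + 1 := ⟨n - 1, by omega⟩
  have hev := eventually_mul_numMonomials_two_mul_le hlt n' n n
  rw [← hn'] at hev
  have hmono : Monotone (numMonomials n) := hn' ▸ monotone_numMonomials n'
  filter_upwards [hev] with i ⟨hi, hle⟩
  set E₀ := tailRegion n r (n - r) (2 * i) with hE₀
  set E₁ := tailRegion n t (n - r - 1) (2 * i) with hE₁
  set X : ℕ → Finset (Fin n →₀ ℕ) := fun j =>
    if 0 < l j ∧ r < j + l j then tailRegion n (j + 1) (n - (j + l j)) (2 * i) \ E₀ else ∅ with hX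
  have hsub : gaps M i ⊆ E₀ ∪ (range 6).biUnion X := by
    intro x hx
    rw [mem_union]
    by_cases hxE : x ∈ E₀
    · exact Or.inl hxE
    obtain ⟨j, hj, hxj⟩ := exists_tailRegion_of_mem_gaps hM hx
    obtain ⟨hjr, hrj, -, -⟩ := hpos hj
    refine Or.inr (mem_biUnion.2 ⟨j, mem_range.2 (by omega), ?_⟩)
    have hrj' : r < j + rowLen M j := by
      refine lt_of_le_of_ne hrj fun h => hxE ?_
      exact tailRegion_mono (by omega) (by omega) hxj
    rw [hX]
    simp only [hldef, if_pos (And.intro hj hrj')]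
    exact mem_sdiff.2 ⟨hxj, hxE⟩
  have hXcard : ∀ j ∈ range 6, 2 ^ (n - 1) * (X j).card ≤
      excessCoeff l n r j * numMonomials n (2 * i + n) := by
    intro j hj
    rw [hX, excessCoeff]
    simp only
    split_ifs with h
    · obtain ⟨hjr, -, -, hjt⟩ := hpos h.1
      have hjt := hjt hl0 h.2
      have hlj : l j ≤ 25 := by
        obtain ⟨h1, h2, h3, h4, h5, hsum⟩ := hl.chain
        have hj6 := mem_range.1 hj
        interval_cases j <;> omega
      have h6 := two_pow_mul_card_sdiff_le (n := n) (a := j + 1) (r := r) (c := n - (j + l j))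
        (m₁ := n - l j) (m₂ := l j - 2) (by omega) (by omega) (by omega) (by omega) (by omega)
        (2 * i)
      rw [show n - r - (n - (j + l j)) = j + l j - r by omega,
        show n - l j + (l j - 2) = n - 2 by omega] at h6
      have h7 : numMonomials n (2 * i + (n - 2)) ≤ numMonomials n (2 * i + n) := hmono (by omega)
      have h8 : 2 ^ (n - 1) = 2 * 2 ^ (n - 2) := by
        rw [← pow_succ']
        congr 1
        omega
      rw [h8, mul_assoc, mul_assoc]
      exact Nat.mul_le_mul_left _ (h6.trans (Nat.mul_le_mul_left _ h7))
    · simp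
  have h1 : (gaps M i).card ≤ E₀.card + ∑ j ∈ range 6, (X j).card :=
    (Finset.card_le_card hsub).trans
      ((Finset.card_union_le _ _).trans (Nat.add_le_add_left card_biUnion_le _))
  have h2 : E₀.card + (E₁ \ E₀).card ≤ (gaps (lexExps n u) i).card := by
    rw [← Finset.card_union_of_disjoint Finset.disjoint_sdiff]
    refine Finset.card_le_card (Finset.union_subset ?_ (Finset.sdiff_subset.trans ?_))
    · exact balanced_subset_gaps_lexExps hu (by omega) (by omega) i
    · exact unbalanced_subset_gaps_lexExps hu hrt.le (by omega) ht i
  have h3 := le_two_pow_mul_card_sdiff (n := n) (t := t) (r := r) (m := m) ht (by omega) (by omega)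
    (show m + 1 ≤ 2 * i by omega)
  have h4 : 2 ^ (n - 1) * ∑ j ∈ range 6, (X j).card ≤
      (∑ j ∈ range 6, excessCoeff l n r j) * numMonomials n (2 * i + n) := by
    rw [Finset.mul_sum, Finset.sum_mul]
    exact Finset.sum_le_sum hXcard
  have h5 : 2 * chooseSum m t * numMonomials n (2 * i - n) ≤
      2 * chooseSum m t * numMonomials n (2 * i - (m + 1)) :=
    Nat.mul_le_mul_left _ (hmono (by omega))
  have h6 : chooseSum (m + 1) t * numMonomials n (2 * i + (m + 1)) ≤
      chooseSum (m + 1) t * numMonomials n (2 * i + n) :=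
    Nat.mul_le_mul_left _ (hmono (by omega))
  rw [add_mul] at hle
  have h7 : 2 ^ (n - 1) * ∑ j ∈ range 6, (X j).card ≤ 2 ^ (n - 1) * (E₁ \ E₀).card := by
    simp only [hE₁, hE₀] at *
    omega
  have h8 := Nat.le_of_mul_le_mul_left h7 (by positivity)
  omega

theorem eventually_card_gaps_le {M : Set (Fin n →₀ ℕ)} (hM : IsStronglyStable 2 M) {u s : ℕ}
    (hn : 80 ≤ n) (hs : s ≤ 25) (hu : u + s = (n + 1).choose 2) (hcard : M.ncard = u) :
    ∀ᶠ i in atTop, (gaps M i).card ≤ (gaps (lexExps n u) i).card := by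
  have hl := isStrictRows_rowLen hM hn hs hu hcard
  obtain ⟨r, t, hr, ht, hrt⟩ := exists_triangular hs
  rcases Nat.eq_zero_or_pos r with rfl | hr0
  · refine Eventually.of_forall fun i => ?_
    have hempty : gaps M i = ∅ := by
      refine Finset.eq_empty_of_forall_notMem fun x hx => ?_
      obtain ⟨j, hj, -⟩ := exists_tailRegion_of_mem_gaps hM hx
      have hj6 : j < 6 := by
        by_contra h
        exact hj.ne' (hl.eq_zero j (not_lt.1 h))
      obtain ⟨h1, h2, h3, h4, h5, hsum⟩ := hl.chain
      norm_num at hrt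
      interval_cases j <;> omega
    simp [hempty]
  rcases Nat.eq_zero_or_pos (rowLen M (r - 1)) with h0 | h0
  · exact eventually_card_gaps_le_of_few_rows hM hn hs hu hr0 hr ht hrt hl h0
  rcases le_or_gt (rowLen M 0) (r + 1) with hl0 | hl0
  · exact Eventually.of_forall fun i => Finset.card_le_card
      (gaps_subset_of_short_first_row hM hn hu hr0 hr ht hrt hl h0 hl0 i)
  · exact eventually_card_gaps_le_of_long_first_row hM hn hs hu hr0 hr ht hrt hl h0 hl0

theorem finite_isStronglyStable (n D : ℕ) : {M : Set (Fin n →₀ ℕ) | IsStronglyStable D M}.Finite :=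
  (finite_degree_eq n D).finite_subsets.subset fun _ hM m hm => hM.1 m hm

theorem finite_of_isStronglyStable {D : ℕ} {M : Set (Fin n →₀ ℕ)} (hM : IsStronglyStable D M) :
    M.Finite :=
  (finite_degree_eq n D).subset fun m hm => hM.1 m hm

/-- The Hilbert function of `k[Lex(u)]` is eventually at most that of `k[M]`, for all strongly stable
sets `M` of `u` quadratic monomials at once. -/
theorem eventually_hilbertFn_lexForms_le (k : Type*) [Field k] {u s : ℕ} (hn : 80 ≤ n)
    (hs : s ≤ 25) (hu : u + s = (n + 1).choose 2) :
    ∀ᶠ i in atTop, ∀ M : Set (Fin n →₀ ℕ), IsStronglyStable 2 M → M.ncard = u →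
      hilbertFn k (lexForms k n u) i ≤ hilbertFn k (monomialForms k M) i := by
  have h : ∀ᶠ i in atTop, ∀ M ∈ {M : Set (Fin n →₀ ℕ) | IsStronglyStable 2 M}, M.ncard = u →
      (gaps M i).card ≤ (gaps (lexExps n u) i).card := by
    -- There are finitely many strongly stable sets, so one threshold serves them all.
    rw [Filter.eventually_all_finite (finite_isStronglyStable n 2)]
    intro M hM
    by_cases hcard : M.ncard = u
    · filter_upwards [eventually_card_gaps_le hM hn hs hu hcard] with i hi _ using hi
    · exact Eventually.of_forall fun i h => absurd h hcard
  filter_upwards [h] with i hi M hM hcard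
  have hL := isStronglyStable_lexExps n u
  rw [lexForms_eq, hilbertFn_monomialForms (finite_of_isStronglyStable hL),
    hilbertFn_monomialForms (finite_of_isStronglyStable hM)]
  have h1 := ncard_sumset_add_card_gaps hM.1 i
  have h2 := ncard_sumset_add_card_gaps hL.1 i
  have h3 := hi M hM hcard
  omega

end Comparison

end QuadricSubalgebra

theorem theorem3p10 (k : Type*) [Field k] (n s u : ℕ) (hn : 80 ≤ n) (hs : s ≤ 25)
    (hu : u = (n + 1).choose 2 - s) :
    QuadricSubalgebra.IsFormSet k 2 u (QuadricSubalgebra.lexForms k n u) ∧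
    ∃ N : ℕ, ∀ i > N,
      QuadricSubalgebra.hilbertFn k (QuadricSubalgebra.lexForms k n u) i =
        QuadricSubalgebra.minStronglyStable k n 2 u i ∧
      ∀ W : Set (MvPolynomial (Fin n) k), QuadricSubalgebra.IsFormSet k 2 u W →
        QuadricSubalgebra.hilbertFn k (QuadricSubalgebra.lexForms k n u) i ≤
          QuadricSubalgebra.hilbertFn k W i := by
  -- The truncated subtraction defining u is genuine, as there are at least 3240 quadratic
  -- monomials.
  have hu' : u + s = (n + 1).choose 2 := by
    have : (80 + 1).choose 2 ≤ (n + 1).choose 2 := Nat.choose_le_choose 2 (by omega)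
    have h81 : (80 + 1).choose 2 = 3240 := by decide
    omega
  have hle : u ≤ (n + 1).choose 2 := by omega
  refine ⟨QuadricSubalgebra.isFormSet_lexForms k hle, ?_⟩
  obtain ⟨N, hN⟩ := Filter.eventually_atTop.1
    (QuadricSubalgebra.eventually_hilbertFn_lexForms_le k hn hs hu')
  refine ⟨N, fun i hi => ⟨le_antisymm ?_ ?_, fun W hW => ?_⟩⟩
  -- Lex(u) itself shows that the infimum is not over the empty set, where it would be 0.
  · refine le_csInf ⟨_, _, QuadricSubalgebra.isStronglyStable_lexExps n u,
      QuadricSubalgebra.ncard_lexExps hle, rfl⟩ ?_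
    rintro _ ⟨M, hM, hcard, rfl⟩
    exact hN i hi.le M hM hcard
  · refine Nat.sInf_le ⟨_, QuadricSubalgebra.isStronglyStable_lexExps n u,
      QuadricSubalgebra.ncard_lexExps hle, ?_⟩
    rw [QuadricSubalgebra.lexForms_eq]
  · obtain ⟨M, hM, hcard, hMW⟩ := QuadricSubalgebra.exists_isStronglyStable_le hW
    exact (hN i hi.le M hM hcard).trans (hMW i)
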